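/- Let $\mathbb K=\mathbb R$ or $\mathbb C$, let $n\ge 2$ and $1\le k\le n$ be integers, and let $X_1,\dots,X_n,Y$ be Banach spaces over $\mathbb K$. For $0<r<\infty$, let $\ell_r^w(X)$ be the space of sequences $(x_j)_{j\ge1}$ in $X$ with $(\varphi(x_j))_j\in\ell_r(\mathbb K)$ for every $\varphi\in X^*$. For $0<r,r_1,\dots,r_n<\infty$, let $\Pi^n_{(r;r_1,\dots,r_n)}(X_1,\dots,X_n;Y)$ be the set of all continuous $n$-linear operators $T:X_1\times\cdots\times X_n\to Y$ such that $\sum_j\|T(x^{(1)}_j,\dots,x^{(n)}_j)\|^{r}<\infty$ whenever $(x^{(i)}_j)_j\in\ell^w_{r_i}(X_i)$ for $i=1,\dots,n$. A Banach space $X$ has cotype $s\ge2$ if there is a constant $C$ such that $$\Bigl(\sum_{j=1}^m\|x_j\|^s\Bigr)^{1/s}\le C\Bigl(2^{-m}\sum_{\varepsilon\in\{-1,1\}^m}\Bigl\|\sum_{j=1}^m\varepsilon_jx_j\Bigr\|^2\Bigr)^{1/2}$$ for all $m$ and all $x_1,\dots,x_m\in X$. Write $s^*=s/(s-1)$. Suppose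 that $X_i$ has cotype $s_i$ with $2\le s_i<\infty$ for $i=1,\dots,k$, and that real numbers $p,q$ satisfy either - $1\le p\le q<\min_{1\le i\le k}s_i^*$, if $s_i>2$ for some $i\in\{1,\dots,k\}$; or - $1\le p\le q\le 2$, if $s_i=2$ for all $i=1,\dots,k$. Then, for all real $z,t\ge1$, $$\Pi^n_{(z;q,\dots,q,t,\dots,t)}(X_1,\dots,X_n;Y)=\Pi^n_{\left(\frac{zqp}{zk(q-p)+qp};\,p,\dots,p,t,\dots,t\right)}(X_1,\dots,X_n;Y),$$ where $q$ and $p$ are each repeated $k$ times and $t$ is repeated $n-k$ times. In particular, if $k=n$, then for all real $z\ge1$, $$\Pi^n_{(z;q,\dots,q)}(X_1,\dots,X_n;Y)=\Pi^n_{\left(\frac{zqp}{zk(q-p)+qp};\,p,\dots,p\right)}(X_1,\dots,X_n;Y).$$ -/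

import Mathlib

noncomputable section

/-- `X` has cotype `s`: for some constant `C`, every finite family satisfies
`(∑ ‖x_j‖ ^ s) ^ (1/s) ≤ C (E ‖∑ ε_j x_j‖ ^ 2) ^ (1/2)`, where the expectation is the average over
all `2 ^ m` choices of signs `ε_j = ± 1`, that is, the integral over `[0,1]` with the Rademacher
functions in place of the `ε_j`. -/
def HasCotype (X : Type*) [NormedAddCommGroup X] (s : ℝ) : Prop :=
  ∃ C : ℝ, ∀ (m : ℕ) (x : Fin m → X),
    (∑ j, ‖x j‖ ^ s) ^ (1 / s) ≤
      C * Real.sqrt ((∑ ε : Fin m → ℤˣ, ‖∑ j, (ε j : ℤ) • x j‖ ^ 2) / 2 ^ m)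

/-- The sequence `x` belongs to `ℓ_p^w(X)`: `(φ (x_j))_j ∈ ℓ_p(𝕜)` for every `φ` in the dual. -/
def IsWeaklySummable (𝕜 : Type*) [RCLike 𝕜] {X : Type*} [NormedAddCommGroup X]
    [NormedSpace 𝕜 X] (p : ℝ) (x : ℕ → X) : Prop :=
  ∀ φ : X →L[𝕜] 𝕜, Memℓp (E := fun _ : ℕ => 𝕜) (fun j => φ (x j)) (ENNReal.ofReal p)

/-- The class of continuous `n`-linear operators that are absolutely
`(p; q_1, …, q_n)`-summing (for exponents in `(0, ∞)`). -/
def absSummingClass (𝕜 : Type*) [RCLike 𝕜] {n : ℕ} (X : Fin n → Type*)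
    [∀ i, NormedAddCommGroup (X i)] [∀ i, NormedSpace 𝕜 (X i)]
    (Y : Type*) [NormedAddCommGroup Y] [NormedSpace 𝕜 Y]
    (p : ℝ) (q : Fin n → ℝ) : Set (ContinuousMultilinearMap 𝕜 X Y) :=
  {T | ∀ x : (i : Fin n) → ℕ → X i, (∀ i, IsWeaklySummable 𝕜 (q i) (x i)) →
    Memℓp (E := fun _ : ℕ => Y) (fun j => T (fun i => x i j)) (ENNReal.ofReal p)}

/-- The tuple of `n` exponents `(a, …, a, t, …, t)` with `a` repeated `k` times. -/
def headTail (n k : ℕ) (a t : ℝ) : Fin n → ℝ :=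
  fun i => if (i : ℕ) < k then a else t

end

/-! Let p < q (for p = q the two classes coincide) and put 1/ρ = 1/p - 1/q. The new exponent r is
the one with 1/r = 1/z + k/ρ, so both inclusions are forms of Hölder's inequality.

From r to z no cotype is needed. Multiplying weakly q-summable sequences by a scalar sequence in ℓ_ρ
makes them weakly p-summable. Doing this in the first k variables shows that the sequence ‖T x_j‖^r
pairs summably with every nonnegative sequence in ℓ_{ρ/(kr)}, hence lies in the dual space ℓ_{z/r}
(`absSummingClass_subset_of_lt`).

From z to r the converse is needed: in X_i with i ≤ k, every weakly p-summable sequence is the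
product of an ℓ_ρ sequence and a weakly q-summable one (`IsSummingFromLinfty.exists_factorization`).
Cotype enters only here. For q' conjugate to q, the hypotheses say q' > s_i or q' = s_i = 2, and in
both cases operators from finite-dimensional ℓ_∞ into X_i are q'-summing with uniform constants
(Maurey): `HasCotype.isSummingFromLinfty`, `HasCotype.isSummingFromLinfty_two`. By duality, ∑_j (∑_k
|φ_k(x_j)|^q)^{p/q} is bounded over all finite families with ∑ ‖φ_k‖^q ≤ 1. Minimax and compactness
(`exists_common_weight`, `IsSummingFromLinfty.exists_weight`) turn this into one summable weight μ
with ∑_j |φ(x_j)|^q μ_j^{-(q/p-1)} bounded on the dual unit ball; the scalar factor is a power of μ.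
-/

/-! ### Cotype and (s, 1)-summing operators on ℓ_∞ -/

/-- A real power lies above its tangent lines. -/
theorem rpow_tangent_le {s a t : ℝ} (hs : 1 < s) (ha : 0 ≤ a) (ht : 0 ≤ t) :
    a ^ s + s * a ^ (s - 1) * (t - a) ≤ t ^ s := by
  rcases ha.eq_or_lt with rfl | ha
  · rw [Real.zero_rpow (by linarith), Real.zero_rpow (by linarith)]
    simpa using Real.rpow_nonneg ht s
  · have h := one_add_mul_self_le_rpow_one_add (s := t / a - 1) (p := s)
      (by have := div_nonneg ht ha.le; linarith) hs.le
    have h2 : (1 + (t / a - 1)) ^ s = t ^ s / a ^ s := by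
      rw [show 1 + (t / a - 1) = t / a by ring, Real.div_rpow ht ha.le]
    have hpos : 0 < a ^ s := Real.rpow_pos_of_pos ha s
    rw [h2, le_div_iff₀ hpos] at h
    have h3 : a ^ (s - 1) * a = a ^ s := by
      rw [← Real.rpow_add_one ha.ne']; congr 1; ring
    have : (1 + s * (t / a - 1)) * a ^ s = a ^ s + s * a ^ (s - 1) * (t - a) := by
      rw [← h3]; field_simp
    linarith

/-- Cotype in terms of families indexed by an arbitrary finite type. -/
theorem HasCotype.exists_sum_rpow_le {X : Type*} [NormedAddCommGroup X] {s : ℝ}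
    (hs : 0 < s) (h : HasCotype X s) :
    ∃ C : ℝ, 0 < C ∧ ∀ (m : ℕ) (x : Fin m → X),
      ∑ j, ‖x j‖ ^ s ≤
        (C * Real.sqrt ((∑ ε : Fin m → ℤˣ, ‖∑ j, (ε j : ℤ) • x j‖ ^ 2) / 2 ^ m)) ^ s := by
  obtain ⟨C, hC⟩ := h
  refine ⟨max C 1, by positivity, fun m x => ?_⟩
  have h0 : 0 ≤ ∑ j, ‖x j‖ ^ s := Finset.sum_nonneg fun _ _ => by positivity
  have h1 := (hC m x).trans
    (mul_le_mul_of_nonneg_right (le_max_left C 1) (Real.sqrt_nonneg _))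
  calc ∑ j, ‖x j‖ ^ s = ((∑ j, ‖x j‖ ^ s) ^ (1 / s)) ^ s := by
        rw [← Real.rpow_mul h0, one_div_mul_cancel hs.ne', Real.rpow_one]
    _ ≤ _ := Real.rpow_le_rpow (by positivity) h1 hs.le

theorem card_signs (m : ℕ) : Fintype.card (Fin m → ℤˣ) = 2 ^ m := by
  simp

theorem norm_units_int_zsmul {X : Type*} [SeminormedAddCommGroup X] (e : ℤˣ) (x : X) :
    ‖(e : ℤ) • x‖ = ‖x‖ := by
  rcases Int.units_eq_one_or e with rfl | rfl <;> simp

section Operators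

variable {𝕜 : Type*} [RCLike 𝕜] {X : Type*} [NormedAddCommGroup X] [NormedSpace 𝕜 X]

/-- An operator from a finite-dimensional `ℓ_∞` into a space of cotype `s` is
`(s, 1)`-summing. -/
theorem HasCotype.exists_sum_rpow_le_of_sum_norm_le {s : ℝ} (hs : 0 < s) (h : HasCotype X s) :
    ∃ K : ℝ, 0 < K ∧ ∀ {ι : Type} [Fintype ι] (v : (ι → 𝕜) →L[𝕜] X), ‖v‖ ≤ 1 →
      ∀ (m : ℕ) (b : Fin m → ι → 𝕜), (∀ j, ∑ k, ‖b k j‖ ≤ 1) → ∑ k, ‖v (b k)‖ ^ s ≤ K := by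
  obtain ⟨C, hC, H⟩ := h.exists_sum_rpow_le hs
  refine ⟨C ^ s, by positivity, fun {ι} _ v hv m b hb => (H m fun k => v (b k)).trans ?_⟩
  refine Real.rpow_le_rpow (by positivity) ?_ hs.le
  have : Real.sqrt ((∑ ε : Fin m → ℤˣ, ‖∑ j, (ε j : ℤ) • v (b j)‖ ^ 2) / 2 ^ m) ≤ 1 := by
    rw [← Real.sqrt_one]
    refine Real.sqrt_le_sqrt ?_
    rw [div_le_one (by positivity)]
    -- Every signed sum of the `b j` lies in the unit ball of ℓ_∞, so the Rademacher average is at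
    -- most 1.
    calc ∑ ε : Fin m → ℤˣ, ‖∑ j, (ε j : ℤ) • v (b j)‖ ^ 2 ≤ ∑ ε : Fin m → ℤˣ, (1 : ℝ) := by
          refine Finset.sum_le_sum fun ε _ => pow_le_one₀ (norm_nonneg _) ?_
          have : ∑ j, (ε j : ℤ) • v (b j) = v (∑ j, (ε j : ℤ) • b j) := by
            rw [map_sum]
            exact Finset.sum_congr rfl fun k _ => (map_zsmul v _ _).symm
          rw [this]
          refine (v.le_of_opNorm_le hv _).trans ?_
          rw [one_mul, pi_norm_le_iff_of_nonneg zero_le_one]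
          intro i
          rw [Finset.sum_apply]
          refine (norm_sum_le _ _).trans (le_trans (le_of_eq ?_) (hb i))
          exact Finset.sum_congr rfl fun k _ => norm_units_int_zsmul _ _
      _ = 2 ^ m := by simp
  nlinarith

/-- Pisier's strengthening of the `(s, 1)`-summing property of operators on `ℓ_∞`: the bound is
linear in the pointwise multiplicity of the family. -/
theorem sum_mul_norm_rpow_le_of_summing {s K : ℝ} (hs : 1 < s) {ι : Type} [Fintype ι]
    {v : (ι → 𝕜) →L[𝕜] X}
    (H : ∀ (m : ℕ) (b : Fin m → ι → 𝕜), (∀ j, ∑ k, ‖b k j‖ ≤ 1) → ∑ k, ‖v (b k)‖ ^ s ≤ K)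
    {I : Type*} [Fintype I] (d : I → ι → 𝕜) (w : I → ℝ) (hw : ∀ i, 0 ≤ w i)
    (hd : ∀ i j, ‖d i j‖ ≤ 1) {M : ℝ} (hM : 0 < M) (hwd : ∀ j, ∑ i, w i * ‖d i j‖ ≤ M) :
    ∑ i, w i * ‖v (d i)‖ ^ s ≤ s * K * M := by
  set A : Set ℝ := {t | ∃ (m : ℕ) (b : Fin m → ι → 𝕜), (∀ j, ∑ k, ‖b k j‖ ≤ 1) ∧
    t = ∑ k, ‖v (b k)‖ ^ s} with hA
  have hAb : BddAbove A := ⟨K, by rintro _ ⟨m, b, hb, rfl⟩; exact H m b hb⟩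
  have hAn : A.Nonempty := ⟨_, 0, Fin.elim0, by simp, rfl⟩
  set S := sSup A with hS
  have hle : ∀ (m : ℕ) (b : Fin m → ι → 𝕜), (∀ j, ∑ k, ‖b k j‖ ≤ 1) →
      ∑ k, ‖v (b k)‖ ^ s ≤ S := fun m b hb => le_csSup hAb ⟨m, b, hb, rfl⟩
  have hSK : S ≤ K := csSup_le hAn (by rintro _ ⟨m, b, hb, rfl⟩; exact H m b hb)
  set N := ∑ i, w i with hN
  have hN0 : 0 ≤ N := Finset.sum_nonneg fun i _ => hw i
  suffices h : ∑ i, w i * ‖v (d i)‖ ^ s ≤ s * S * M by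
    refine h.trans ?_
    gcongr
  refine le_of_forall_pos_le_add fun δ hδ => ?_
  -- A nearly extremal family `b` is perturbed: shrinking it by `1 - ‖d i‖` makes room for `d i`.
  -- What `d i` contributes is then at most what `b` loses, and the loss is linear in `D` to first
  -- order.
  obtain ⟨_, ⟨m, b, hb, rfl⟩, hbS⟩ := exists_lt_of_lt_csSup hAn
    (show S - δ / (N + 1) < S by have : 0 < δ / (N + 1) := by positivity
                                 linarith)
  have hone : ∀ i, ∑ k, ‖v fun j => b k j * ((1 - ‖d i j‖ : ℝ) : 𝕜)‖ ^ s + ‖v (d i)‖ ^ s ≤ S := by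
    intro i
    have := hle (m + 1) (Fin.snoc (fun k j => b k j * ((1 - ‖d i j‖ : ℝ) : 𝕜)) (d i)) ?_
    · simpa [Fin.sum_univ_castSucc] using this
    · intro j
      simp only [Fin.sum_univ_castSucc, Fin.snoc_castSucc, Fin.snoc_last, norm_mul,
        RCLike.norm_ofReal, abs_of_nonneg (sub_nonneg.2 (hd i j)), ← Finset.sum_mul]
      nlinarith [hb j, hd i j, norm_nonneg (d i j)]
  set D : ι → ℝ := fun j => ∑ i, w i * ‖d i j‖ with hD
  have hD0 : ∀ j, 0 ≤ D j := fun j =>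
    Finset.sum_nonneg fun i _ => mul_nonneg (hw i) (norm_nonneg _)
  have hmean : ∀ k, N * ‖v (b k)‖ ^ s - s * ‖v (b k)‖ ^ (s - 1) * ‖v fun j => b k j * (D j : 𝕜)‖
      ≤ ∑ i, w i * ‖v fun j => b k j * ((1 - ‖d i j‖ : ℝ) : 𝕜)‖ ^ s := by
    intro k
    set a := ‖v (b k)‖ with ha
    have hsum : N * a - ‖v fun j => b k j * (D j : 𝕜)‖ ≤
        ∑ i, w i * ‖v fun j => b k j * ((1 - ‖d i j‖ : ℝ) : 𝕜)‖ := by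
      have h1 : ∑ i, (w i : 𝕜) • (v fun j => b k j * ((1 - ‖d i j‖ : ℝ) : 𝕜)) =
          (N : 𝕜) • v (b k) - v fun j => b k j * (D j : 𝕜) := by
        rw [← map_smul, ← map_sub]
        simp_rw [← map_smul]
        rw [← map_sum]
        congr 1
        ext j
        simp only [Finset.sum_apply, Pi.smul_apply, Pi.sub_apply, smul_eq_mul, hN, hD]
        push_cast
        rw [Finset.sum_mul, Finset.mul_sum, ← Finset.sum_sub_distrib]
        exact Finset.sum_congr rfl fun i _ => by ring
      have h2 : ‖(N : 𝕜) • v (b k)‖ = N * a := by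
        rw [norm_smul, RCLike.norm_ofReal, abs_of_nonneg hN0]
      calc N * a - ‖v fun j => b k j * (D j : 𝕜)‖ ≤
          ‖(N : 𝕜) • v (b k) - v fun j => b k j * (D j : 𝕜)‖ := by
            rw [← h2]; exact norm_sub_norm_le _ _
        _ ≤ ∑ i, ‖(w i : 𝕜) • (v fun j => b k j * ((1 - ‖d i j‖ : ℝ) : 𝕜))‖ := by
            rw [← h1]; exact norm_sum_le _ _
        _ = _ := Finset.sum_congr rfl fun i _ => by
            rw [norm_smul, RCLike.norm_ofReal, abs_of_nonneg (hw i)]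
    have htan : ∀ i, w i * (a ^ s + s * a ^ (s - 1) *
        (‖v fun j => b k j * ((1 - ‖d i j‖ : ℝ) : 𝕜)‖ - a)) ≤
        w i * ‖v fun j => b k j * ((1 - ‖d i j‖ : ℝ) : 𝕜)‖ ^ s := fun i =>
      mul_le_mul_of_nonneg_left (rpow_tangent_le hs (norm_nonneg _) (norm_nonneg _)) (hw i)
    refine le_trans ?_ (Finset.sum_le_sum fun i _ => htan i)
    have h3 : ∑ i, w i * (a ^ s + s * a ^ (s - 1) *
        (‖v fun j => b k j * ((1 - ‖d i j‖ : ℝ) : 𝕜)‖ - a)) = N * a ^ s + s * a ^ (s - 1) *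
        (∑ i, w i * ‖v fun j => b k j * ((1 - ‖d i j‖ : ℝ) : 𝕜)‖ - N * a) := by
      rw [mul_sub, Finset.mul_sum, hN, Finset.sum_mul, Finset.sum_mul, Finset.mul_sum,
        ← Finset.sum_sub_distrib, ← Finset.sum_add_distrib]
      exact Finset.sum_congr rfl fun i _ => by ring
    rw [h3]
    have : 0 ≤ s * a ^ (s - 1) := by positivity
    nlinarith
  -- The tangent inequality again, now as Young's inequality. Since `D / M ≤ 1`, the family `b * (D
  -- / M)` is admissible, so the total loss is at most M(S + (s - 1)S) = sSM.
  have hDk : ∀ k, s * ‖v (b k)‖ ^ (s - 1) * ‖v fun j => b k j * (D j : 𝕜)‖ ≤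
      M * (‖v fun j => b k j * ((D j / M : ℝ) : 𝕜)‖ ^ s + (s - 1) * ‖v (b k)‖ ^ s) := by
    intro k
    have h1 : ‖v fun j => b k j * (D j : 𝕜)‖ = M * ‖v fun j => b k j * ((D j / M : ℝ) : 𝕜)‖ := by
      have : (fun j => b k j * (D j : 𝕜)) = (M : 𝕜) • fun j => b k j * ((D j / M : ℝ) : 𝕜) := by
        ext j
        have : (M : 𝕜) ≠ 0 := by exact_mod_cast hM.ne'
        simp only [Pi.smul_apply, smul_eq_mul]
        push_cast
        field_simp
      rw [this, map_smul, norm_smul, RCLike.norm_ofReal, abs_of_pos hM]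
    rw [h1]
    have h2 := rpow_tangent_le hs (norm_nonneg (v (b k)))
      (norm_nonneg (v fun j => b k j * ((D j / M : ℝ) : 𝕜)))
    have h3 : ‖v (b k)‖ ^ (s - 1) * ‖v (b k)‖ = ‖v (b k)‖ ^ s := by
      rw [← Real.rpow_add_one' (norm_nonneg _) (by linarith)]; congr 1; ring
    rw [mul_sub, mul_assoc s _ ‖v (b k)‖, h3] at h2
    calc _ = M * (s * ‖v (b k)‖ ^ (s - 1) * ‖v fun j => b k j * ((D j / M : ℝ) : 𝕜)‖) := by ring
      _ ≤ _ := mul_le_mul_of_nonneg_left (by linarith) hM.le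
  have hDS : ∑ k, ‖v fun j => b k j * ((D j / M : ℝ) : 𝕜)‖ ^ s ≤ S := by
    refine hle m _ fun j => ?_
    have hDM : D j / M ≤ 1 := (div_le_one hM).2 (hwd j)
    have hDM0 : 0 ≤ D j / M := div_nonneg (hD0 j) hM.le
    simp only [norm_mul, RCLike.norm_ofReal, abs_of_nonneg hDM0, ← Finset.sum_mul]
    have : 0 ≤ ∑ k, ‖b k j‖ := by positivity
    nlinarith [hb j]
  have hbS' := hle m b hb
  have e1 : ∑ i, w i * (∑ k, ‖v fun j => b k j * ((1 - ‖d i j‖ : ℝ) : 𝕜)‖ ^ s + ‖v (d i)‖ ^ s) ≤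
      N * S := by
    rw [hN, Finset.sum_mul]
    exact Finset.sum_le_sum fun i _ => mul_le_mul_of_nonneg_left (hone i) (hw i)
  have e2 : ∑ i, w i * (∑ k, ‖v fun j => b k j * ((1 - ‖d i j‖ : ℝ) : 𝕜)‖ ^ s + ‖v (d i)‖ ^ s) =
      ∑ k, ∑ i, w i * ‖v fun j => b k j * ((1 - ‖d i j‖ : ℝ) : 𝕜)‖ ^ s +
        ∑ i, w i * ‖v (d i)‖ ^ s := by
    rw [Finset.sum_comm, ← Finset.sum_add_distrib]
    exact Finset.sum_congr rfl fun i _ => by rw [mul_add, Finset.mul_sum]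
  have e3 := Finset.sum_le_sum fun k (_ : k ∈ Finset.univ) => hmean k
  have e4 := Finset.sum_le_sum fun k (_ : k ∈ Finset.univ) => hDk k
  rw [Finset.sum_sub_distrib, ← Finset.mul_sum] at e3
  rw [← Finset.mul_sum, Finset.sum_add_distrib, ← Finset.mul_sum] at e4
  have e5 : N * (S - ∑ k, ‖v (b k)‖ ^ s) ≤ δ := by
    have h1 : S - ∑ k, ‖v (b k)‖ ^ s ≤ δ / (N + 1) := by linarith
    calc N * (S - ∑ k, ‖v (b k)‖ ^ s) ≤ N * (δ / (N + 1)) := by gcongr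
      _ = δ * (N / (N + 1)) := by ring
      _ ≤ δ * 1 := by
          gcongr
          rw [div_le_one (by positivity)]; linarith
      _ = δ := mul_one δ
  have e6 : M * (∑ k, ‖v fun j => b k j * ((D j / M : ℝ) : 𝕜)‖ ^ s +
      (s - 1) * ∑ k, ‖v (b k)‖ ^ s) ≤ s * S * M := by
    have : (s - 1) * ∑ k, ‖v (b k)‖ ^ s ≤ (s - 1) * S := by
      apply mul_le_mul_of_nonneg_left hbS'; linarith
    nlinarith
  nlinarith

end Operators

/-! ### From (s, 1)-summing to r-summing for r > s -/

/-- Every operator from a finite-dimensional `ℓ_∞` into `X` is `r`-summing, with a constant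
controlled by the norm of the operator. -/
def IsSummingFromLinfty (𝕜 : Type*) [RCLike 𝕜] (X : Type*) [NormedAddCommGroup X]
    [NormedSpace 𝕜 X] (r : ℝ) : Prop :=
  ∃ c : ℝ, 0 < c ∧ ∀ {ι : Type} [Fintype ι] (v : (ι → 𝕜) →L[𝕜] X), ‖v‖ ≤ 1 →
    ∀ (m : ℕ) (b : Fin m → ι → 𝕜), (∀ j, ∑ k, ‖b k j‖ ^ r ≤ 1) → ∑ k, ‖v (b k)‖ ^ r ≤ c

/-- Hölder's inequality against a geometric weight. -/
theorem exists_rpow_sum_range_le {s δ : ℝ} (hs : 1 < s) (hδ : 0 < δ) :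
    ∃ G : ℝ, 0 < G ∧ ∀ (L : ℕ) (a : ℕ → ℝ), (∀ l, 0 ≤ a l) →
      (∑ l ∈ Finset.range L, a l) ^ s ≤ G * ∑ l ∈ Finset.range L, (2 ^ δ) ^ l * a l ^ s := by
  -- Chosen so that `σ ^ (s - 1) * 2 ^ δ = 1`: the weights in Hölder's inequality then cancel
  -- exactly.
  set σ : ℝ := 2 ^ (-(δ / (s - 1))) with hσ
  have hσ0 : 0 < σ := by positivity
  have hσ1 : σ < 1 := Real.rpow_lt_one_of_one_lt_of_neg one_lt_two
    (neg_lt_zero.2 (div_pos hδ (by linarith)))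
  have hG : 0 < (1 - σ)⁻¹ := inv_pos.2 (by linarith)
  refine ⟨((1 - σ)⁻¹) ^ (s - 1), by positivity, fun L a ha => ?_⟩
  have h := Real.inner_le_weight_mul_Lp_of_nonneg (Finset.range L) hs.le (fun l => σ ^ l)
    (fun l => a l / σ ^ l) (fun l => by positivity) (fun l => div_nonneg (ha l) (by positivity))
  have h1 : ∀ l, σ ^ l * (a l / σ ^ l) = a l := fun l => by field_simp
  have h2 : ∀ l, σ ^ l * (a l / σ ^ l) ^ s = (2 ^ δ) ^ l * a l ^ s := by
    intro l
    have e1 : (σ ^ l) ^ s = σ ^ l * (σ ^ l) ^ (s - 1) := by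
      rw [mul_comm, ← Real.rpow_add_one (pow_pos hσ0 l).ne']; congr 1; ring
    have e2 : ((2 : ℝ) ^ δ) ^ l * (σ ^ l) ^ (s - 1) = 1 := by
      rw [hσ, ← Real.rpow_natCast, ← Real.rpow_natCast, ← Real.rpow_mul (by norm_num),
        ← Real.rpow_mul (by positivity), ← Real.rpow_mul (by norm_num),
        ← Real.rpow_add (by norm_num)]
      have : s - 1 ≠ 0 := by linarith
      rw [show δ * l + -(δ / (s - 1)) * (l * (s - 1)) = 0 by field_simp; ring, Real.rpow_zero]
    have e3 : 0 < (σ ^ l) ^ (s - 1) := by positivity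
    rw [Real.div_rpow (ha l) (by positivity), e1]
    have : ((2 : ℝ) ^ δ) ^ l = ((σ ^ l) ^ (s - 1))⁻¹ := eq_inv_of_mul_eq_one_left e2
    rw [this]
    field_simp
  simp only [h1, h2] at h
  have hT : 0 ≤ ∑ l ∈ Finset.range L, ((2 : ℝ) ^ δ) ^ l * a l ^ s :=
    Finset.sum_nonneg fun l _ => mul_nonneg (by positivity) (Real.rpow_nonneg (ha l) _)
  have hW : ∑ l ∈ Finset.range L, σ ^ l ≤ (1 - σ)⁻¹ := by
    rw [← tsum_geometric_of_lt_one hσ0.le hσ1]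
    exact (summable_geometric_of_lt_one hσ0.le hσ1).sum_le_tsum _ fun l _ => by positivity
  have hW0 : 0 ≤ ∑ l ∈ Finset.range L, σ ^ l := Finset.sum_nonneg fun l _ => by positivity
  have hs0 : s ≠ 0 := by linarith
  calc (∑ l ∈ Finset.range L, a l) ^ s ≤ ((∑ l ∈ Finset.range L, σ ^ l) ^ (1 - s⁻¹) *
        (∑ l ∈ Finset.range L, ((2 : ℝ) ^ δ) ^ l * a l ^ s) ^ s⁻¹) ^ s :=
        Real.rpow_le_rpow (Finset.sum_nonneg fun l _ => ha l) h (by linarith)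
    _ = (∑ l ∈ Finset.range L, σ ^ l) ^ (s - 1) *
        ∑ l ∈ Finset.range L, ((2 : ℝ) ^ δ) ^ l * a l ^ s := by
        rw [Real.mul_rpow (by positivity) (by positivity), ← Real.rpow_mul hW0,
          ← Real.rpow_mul hT, inv_mul_cancel₀ hs0, Real.rpow_one]
        congr 2; field_simp
    _ ≤ _ := by
        refine mul_le_mul_of_nonneg_right (Real.rpow_le_rpow hW0 hW (by linarith)) hT

section Operators

variable {𝕜 : Type*} [RCLike 𝕜] {X : Type*} [NormedAddCommGroup X] [NormedSpace 𝕜 X]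

/-- Dyadic decomposition of the part of `b` above the threshold `θ`. -/
theorem exists_dyadic_levels {ι : Type} [Fintype ι] {θ : ℝ} (hθ : 0 < θ) (b : ι → 𝕜) :
    ∃ g : ℕ → ι → 𝕜, ∃ L : ℕ,
      (∀ l j, ‖g l j‖ ≤ 2 ^ (l + 1) * θ) ∧ (∀ l j, g l j ≠ 0 → 2 ^ l * θ ≤ ‖b j‖) ∧
      (∀ l l' j, g l j ≠ 0 → g l' j ≠ 0 → l = l') ∧
      ∀ L', L ≤ L' → ∀ j, ‖b j - ∑ l ∈ Finset.range L', g l j‖ ≤ θ := by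
  classical
  have hex : ∀ j, ∃ n : ℕ, θ ≤ ‖b j‖ → 2 ^ n ≤ ‖b j‖ / θ ∧ ‖b j‖ / θ < 2 ^ (n + 1) := by
    intro j
    by_cases h : θ ≤ ‖b j‖
    · obtain ⟨n, hn⟩ := exists_nat_pow_near ((one_le_div hθ).2 h) (one_lt_two)
      exact ⟨n, fun _ => hn⟩
    · exact ⟨0, fun h' => absurd h' h⟩
  choose lev hlev using hex
  have hg : ∀ l j, (if θ ≤ ‖b j‖ ∧ lev j = l then b j else 0) ≠ 0 → θ ≤ ‖b j‖ ∧ lev j = l := by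
    intro l j h
    by_contra h'
    exact h (if_neg h')
  refine ⟨fun l j => if θ ≤ ‖b j‖ ∧ lev j = l then b j else 0, ∑ j, (lev j + 1), ?_, ?_, ?_, ?_⟩
  · intro l j
    dsimp only
    split_ifs with h
    · obtain ⟨h1, rfl⟩ := h
      exact ((div_lt_iff₀ hθ).1 (hlev j h1).2).le
    · rw [norm_zero]; positivity
  · intro l j h
    obtain ⟨h1, rfl⟩ := hg l j h
    exact (le_div_iff₀ hθ).1 (hlev j h1).1
  · intro l l' j h h'
    exact (hg l j h).2.symm.trans (hg l' j h').2
  · intro L' hL j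
    have hj : lev j ∈ Finset.range L' := by
      rw [Finset.mem_range]
      have := Finset.single_le_sum (f := fun j => lev j + 1) (fun _ _ => Nat.zero_le _)
        (Finset.mem_univ j)
      omega
    by_cases h : θ ≤ ‖b j‖
    · have : ∑ l ∈ Finset.range L', (if θ ≤ ‖b j‖ ∧ lev j = l then b j else 0) = b j := by
        simp [h, hj]
      rw [this, sub_self, norm_zero]
      exact hθ.le
    · simp only [h, false_and, if_false, Finset.sum_const_zero, sub_zero]
      exact (not_le.1 h).le

/-- Spaces of cotype `s` have `r`-summing operators from `ℓ_∞` for all `r > s`. -/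
theorem HasCotype.isSummingFromLinfty {s r : ℝ} (hs : 1 < s) (hsr : s < r) (h : HasCotype X s) :
    IsSummingFromLinfty 𝕜 X r := by
  obtain ⟨K, hK, H⟩ := h.exists_sum_rpow_le_of_sum_norm_le (𝕜 := 𝕜) (by linarith)
  obtain ⟨G, hG, hGl⟩ := exists_rpow_sum_range_le hs (sub_pos.2 hsr)
  refine ⟨2 ^ s * G * (s * K * 2 ^ r), by positivity, fun {ι} _ v hv m b hb => ?_⟩
  have hr : 0 < r := by linarith
  set τ : Fin m → ℝ := fun k => ‖v (b k)‖ with hτ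
  set P := {k : Fin m // 0 < τ k}
  -- The part of `b k` below half of `τ k` has image of norm at most `τ k / 2`, so the levels above
  -- that threshold carry at least half of `‖v (b k)‖`.
  have hlevels := fun k : P => exists_dyadic_levels (half_pos k.2) (b k)
  choose g L g2 g3 g4 g5 using hlevels
  set N := ∑ k, L k with hN
  have hLN : ∀ k, L k ≤ N := fun k =>
    Finset.single_le_sum (f := L) (fun _ _ => Nat.zero_le _) (Finset.mem_univ k)
  set α : P → ℕ → ℝ := fun k l => 2 ^ (l + 1) * (τ k / 2) with hα
  have hα0 : ∀ k l, 0 < α k l := fun k l => by have := k.2; positivity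
  set d : P × Fin N → ι → 𝕜 := fun i => ((α i.1 i.2)⁻¹ : 𝕜) • g i.1 i.2 with hd
  -- This weight equals `α ^ r` (see `hwα`). On its support level `l` satisfies `α ≤ 2 ‖b k j‖`, and
  -- levels are disjoint, so the weighted multiplicity is at most `2 ^ r * ∑ k, ‖b k j‖ ^ r`.
  set w : P × Fin N → ℝ := fun i => τ i.1 ^ (r - s) * (2 ^ (r - s)) ^ (i.2 : ℕ) * α i.1 i.2 ^ s
    with hw
  have hw0 : ∀ i, 0 ≤ w i := fun i => by have := hα0 i.1 i.2; positivity
  have hdn : ∀ i j, ‖d i j‖ = ‖g i.1 i.2 j‖ / α i.1 i.2 := fun i j => by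
    rw [show d i j = ((α i.1 i.2)⁻¹ : 𝕜) • g i.1 i.2 j from rfl, norm_smul, norm_inv,
      RCLike.norm_ofReal, abs_of_pos (hα0 _ _), div_eq_inv_mul]
  have key := sum_mul_norm_rpow_le_of_summing hs (H v hv) d w hw0
    (fun i j => by rw [hdn]; exact (div_le_one (hα0 _ _)).2 (g2 _ _ _))
    (M := 2 ^ r) (by positivity) (fun j => ?_)
  · have h1 : ∀ k : P, τ k ^ r ≤ 2 ^ s * G * ∑ l : Fin N, w (k, l) * ‖v (d (k, l))‖ ^ s := by
      intro k
      have hk := k.2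
      have e1 : τ k / 2 ≤ ∑ l ∈ Finset.range N, ‖v (g k l)‖ := by
        have : ‖v (b k - ∑ l ∈ Finset.range N, g k l)‖ ≤ τ k / 2 := by
          refine (v.le_of_opNorm_le hv _).trans ?_
          rw [one_mul, pi_norm_le_iff_of_nonneg (by positivity)]
          intro j
          rw [Pi.sub_apply, Finset.sum_apply]
          exact g5 k N (hLN k) j
        have e2 : τ k = ‖v (b k - ∑ l ∈ Finset.range N, g k l) +
            ∑ l ∈ Finset.range N, v (g k l)‖ := by
          rw [← map_sum, ← map_add, sub_add_cancel]
        have e3 := norm_add_le (v (b k - ∑ l ∈ Finset.range N, g k l))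
          (∑ l ∈ Finset.range N, v (g k l))
        have e4 := norm_sum_le (Finset.range N) fun l => v (g k l)
        linarith
      have e2 := (Real.rpow_le_rpow (by positivity) e1 (by linarith : 0 ≤ s)).trans
        (hGl N (fun l => ‖v (g k l)‖) fun l => norm_nonneg _)
      have e3 : ∀ l : Fin N, w (k, l) * ‖v (d (k, l))‖ ^ s =
          τ k ^ (r - s) * ((2 ^ (r - s)) ^ (l : ℕ) * ‖v (g k l)‖ ^ s) := by
        intro l
        have : ‖v (g k l)‖ = α k l * ‖v (d (k, l))‖ := by
          have hne : (α k l : 𝕜) ≠ 0 := by exact_mod_cast (hα0 k l).ne'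
          have : g k l = (α k l : 𝕜) • d (k, l) := by
            rw [hd]; simp only [smul_smul]; rw [mul_inv_cancel₀ hne, one_smul]
          rw [this, map_smul, norm_smul, RCLike.norm_ofReal, abs_of_pos (hα0 k l)]
        rw [this, Real.mul_rpow (hα0 k l).le (norm_nonneg _), hw]
        ring
      have e4 : ∑ l : Fin N, w (k, l) * ‖v (d (k, l))‖ ^ s =
          τ k ^ (r - s) * ∑ l ∈ Finset.range N, (2 ^ (r - s)) ^ l * ‖v (g k l)‖ ^ s := by
        rw [Finset.sum_congr rfl fun l _ => e3 l, ← Finset.mul_sum,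
          ← Fin.sum_univ_eq_sum_range (fun l => ((2 : ℝ) ^ (r - s)) ^ l * ‖v (g k l)‖ ^ s)]
      have e5 : τ k ^ r = τ k ^ (r - s) * (2 ^ s * (τ k / 2) ^ s) := by
        rw [← Real.mul_rpow (by norm_num) (by positivity), show 2 * (τ k / 2) = τ k by ring,
          ← Real.rpow_add hk]
        congr 1; ring
      rw [e4, e5]
      calc _ ≤ τ k ^ (r - s) * (2 ^ s * (G * ∑ l ∈ Finset.range N,
            (2 ^ (r - s)) ^ l * ‖v (g k l)‖ ^ s)) := by gcongr
        _ = _ := by ring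
    have h2 : ∑ k, τ k ^ r = ∑ k : P, τ k ^ r := by
      classical
      rw [← Finset.sum_subtype (Finset.univ.filter fun k => 0 < τ k) (by simp) fun k => τ k ^ r,
        Finset.sum_filter]
      refine Finset.sum_congr rfl fun k _ => ?_
      split_ifs with hk
      · rfl
      · rw [le_antisymm (not_lt.1 hk) (norm_nonneg _), Real.zero_rpow hr.ne']
    calc ∑ k, τ k ^ r ≤ ∑ k : P, 2 ^ s * G * ∑ l : Fin N, w (k, l) * ‖v (d (k, l))‖ ^ s := by
          rw [h2]; exact Finset.sum_le_sum fun k _ => h1 k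
      _ = 2 ^ s * G * ∑ i, w i * ‖v (d i)‖ ^ s := by
          rw [Fintype.sum_prod_type, Finset.mul_sum]
      _ ≤ _ := by gcongr
  · have hwα : ∀ i, w i = α i.1 i.2 ^ r := by
      intro i
      have h1 : α i.1 i.2 = τ i.1 * 2 ^ (i.2 : ℕ) := by simp only [hα]; ring
      have h2 : ((2 : ℝ) ^ (r - s)) ^ (i.2 : ℕ) = (2 ^ (i.2 : ℕ)) ^ (r - s) := by
        rw [← Real.rpow_natCast, ← Real.rpow_natCast, ← Real.rpow_mul (by norm_num),
          ← Real.rpow_mul (by norm_num), mul_comm]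
      have h3 : w i = τ i.1 ^ (r - s) * (2 ^ (r - s)) ^ (i.2 : ℕ) * α i.1 i.2 ^ s := rfl
      rw [h3, h2, ← Real.mul_rpow i.1.2.le (by positivity), ← h1, ← Real.rpow_add (hα0 _ _)]
      congr 1; ring
    have hterm : ∀ (k : P) (l : Fin N), w (k, l) * ‖d (k, l) j‖ ≤ 2 ^ r * ‖b k j‖ ^ r := by
      intro k l
      by_cases hg : g k l j = 0
      · rw [hdn, hg, norm_zero, zero_div, mul_zero]; positivity
      · have h1 : ‖d (k, l) j‖ ≤ 1 := by rw [hdn]; exact (div_le_one (hα0 _ _)).2 (g2 _ _ _)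
        refine (mul_le_of_le_one_right (hw0 _) h1).trans ?_
        rw [hwα, ← Real.mul_rpow (by norm_num) (norm_nonneg _)]
        refine Real.rpow_le_rpow (hα0 _ _).le ?_ hr.le
        have := g3 k l j hg
        simp only [hα, pow_succ]
        linarith
    have hk : ∀ k : P, ∑ l : Fin N, w (k, l) * ‖d (k, l) j‖ ≤ 2 ^ r * ‖b k j‖ ^ r := by
      intro k
      by_cases h : ∃ l : Fin N, g k l j ≠ 0
      · obtain ⟨l, hl⟩ := h
        rw [Fintype.sum_eq_single l]
        · exact hterm k l
        · intro l' hl'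
          have : g k l' j = 0 := by
            by_contra h'
            exact hl' (Fin.ext (g4 k l' l j h' hl))
          rw [hdn, this, norm_zero, zero_div, mul_zero]
      · push Not at h
        have : ∀ l : Fin N, w (k, l) * ‖d (k, l) j‖ = 0 := fun l => by
          rw [hdn, h l, norm_zero, zero_div, mul_zero]
        rw [Finset.sum_congr rfl fun l _ => this l, Finset.sum_const_zero]
        positivity
    calc ∑ i, w i * ‖d i j‖ = ∑ k : P, ∑ l : Fin N, w (k, l) * ‖d (k, l) j‖ :=
          Fintype.sum_prod_type _
      _ ≤ ∑ k : P, 2 ^ r * ‖b k j‖ ^ r := Finset.sum_le_sum fun k _ => hk k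
      _ = 2 ^ r * ∑ k : P, ‖b k j‖ ^ r := by rw [Finset.mul_sum]
      _ ≤ 2 ^ r * ∑ k, ‖b k j‖ ^ r := by
          classical
          gcongr
          rw [← Finset.sum_subtype (Finset.univ.filter fun k => 0 < τ k) (by simp)
            fun k => ‖b k j‖ ^ r]
          exact Finset.sum_le_sum_of_subset_of_nonneg (Finset.filter_subset _ _)
            fun _ _ _ => by positivity
      _ ≤ 2 ^ r * 1 := by gcongr; exact hb j
      _ = 2 ^ r := mul_one _

end Operators

/-! ### Rademacher moments and the limiting case of cotype 2 -/

theorem sum_signs_succ {m : ℕ} {M : Type*} [AddCommMonoid M] (F : (Fin (m + 1) → ℤˣ) → M) :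
    ∑ ε, F ε = ∑ ε : Fin m → ℤˣ,
      (F (Fin.cons (1 : ℤˣ) ε : Fin (m + 1) → ℤˣ) + F (Fin.cons (-1 : ℤˣ) ε : Fin (m + 1) → ℤˣ)) := by
  rw [← (Fin.consEquiv fun _ : Fin (m + 1) => ℤˣ).sum_comp, Fintype.sum_prod_type,
    Finset.sum_add_distrib]
  have : (Finset.univ : Finset ℤˣ) = {1, -1} := by decide
  rw [this, Finset.sum_pair (by decide)]
  rfl

theorem norm_add_sq_add_norm_sub_sq {𝕜 : Type*} [RCLike 𝕜] (x a : 𝕜) :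
    ‖x + a‖ ^ 2 + ‖x - a‖ ^ 2 = 2 * (‖x‖ ^ 2 + ‖a‖ ^ 2) := by
  have := parallelogram_law_with_norm 𝕜 x a
  nlinarith

/-- For A = ‖x + a‖² and B = ‖x - a‖², A² + B² = ((A + B)² + (A - B)²)/2. The parallelogram law
gives A + B, and Cauchy–Schwarz gives |A - B| ≤ 4‖x‖‖a‖. -/
theorem norm_add_pow_four_add_norm_sub_pow_four_le {𝕜 : Type*} [RCLike 𝕜] (x a : 𝕜) :
    ‖x + a‖ ^ 4 + ‖x - a‖ ^ 4 ≤ 2 * (‖x‖ ^ 4 + 6 * ‖a‖ ^ 2 * ‖x‖ ^ 2 + ‖a‖ ^ 4) := by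
  have h1 := norm_add_sq_add_norm_sub_sq x a
  have h2 : ‖x + a‖ ^ 2 - ‖x - a‖ ^ 2 = 4 * RCLike.re (inner 𝕜 x a) := by
    rw [norm_add_sq (𝕜 := 𝕜), norm_sub_sq (𝕜 := 𝕜)]; ring
  have h3 : RCLike.re (inner 𝕜 x a) ^ 2 ≤ (‖x‖ * ‖a‖) ^ 2 :=
    sq_le_sq' (by
      have h := neg_le_of_abs_le ((RCLike.abs_re_le_norm _).trans (norm_inner_le_norm (𝕜 := 𝕜) x a))
      exact h) ((le_abs_self _).trans ((RCLike.abs_re_le_norm _).trans (norm_inner_le_norm x a)))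
  have h4 : ‖x + a‖ ^ 4 + ‖x - a‖ ^ 4 =
      ((‖x + a‖ ^ 2 + ‖x - a‖ ^ 2) ^ 2 + (‖x + a‖ ^ 2 - ‖x - a‖ ^ 2) ^ 2) / 2 := by ring
  rw [h4, h1, h2]
  nlinarith

theorem sum_signs_norm_sq {𝕜 : Type*} [RCLike 𝕜] {m : ℕ} (a : Fin m → 𝕜) :
    ∑ ε : Fin m → ℤˣ, ‖∑ k, (ε k : ℤ) • a k‖ ^ 2 = 2 ^ m * ∑ k, ‖a k‖ ^ 2 := by
  induction m with
  | zero => simp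
  | succ m ih =>
    rw [sum_signs_succ]
    have : ∀ ε : Fin m → ℤˣ,
        ‖∑ k, ((Fin.cons (1 : ℤˣ) ε : Fin (m + 1) → ℤˣ) k : ℤ) • a k‖ ^ 2 +
          ‖∑ k, ((Fin.cons (-1 : ℤˣ) ε : Fin (m + 1) → ℤˣ) k : ℤ) • a k‖ ^ 2 =
        2 * (‖∑ k, (ε k : ℤ) • a k.succ‖ ^ 2 + ‖a 0‖ ^ 2) := by
      intro ε
      rw [← norm_add_sq_add_norm_sub_sq]
      simp only [Fin.sum_univ_succ, Fin.cons_zero, Fin.cons_succ, Units.val_one, one_smul,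
        Units.val_neg, neg_smul]
      rw [add_comm (a 0), neg_add_eq_sub]
    simp only [this, ← Finset.mul_sum, Finset.sum_add_distrib, ih (fun k => a k.succ),
      Finset.sum_const, Finset.card_univ, card_signs, nsmul_eq_mul]
    rw [Fin.sum_univ_succ]
    push_cast
    ring

/-- Khinchin's inequality for the fourth moment. -/
theorem sum_signs_norm_pow_four_le {𝕜 : Type*} [RCLike 𝕜] {m : ℕ} (a : Fin m → 𝕜) :
    ∑ ε : Fin m → ℤˣ, ‖∑ k, (ε k : ℤ) • a k‖ ^ 4 ≤ 3 * 2 ^ m * (∑ k, ‖a k‖ ^ 2) ^ 2 := by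
  induction m with
  | zero => simp
  | succ m ih =>
    rw [sum_signs_succ]
    have : ∀ ε : Fin m → ℤˣ,
        ‖∑ k, ((Fin.cons (1 : ℤˣ) ε : Fin (m + 1) → ℤˣ) k : ℤ) • a k‖ ^ 4 +
          ‖∑ k, ((Fin.cons (-1 : ℤˣ) ε : Fin (m + 1) → ℤˣ) k : ℤ) • a k‖ ^ 4 ≤
        2 * (‖∑ k, (ε k : ℤ) • a k.succ‖ ^ 4 +
          6 * ‖a 0‖ ^ 2 * ‖∑ k, (ε k : ℤ) • a k.succ‖ ^ 2 + ‖a 0‖ ^ 4) := by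
      intro ε
      refine le_trans (le_of_eq ?_) (norm_add_pow_four_add_norm_sub_pow_four_le _ _)
      simp only [Fin.sum_univ_succ, Fin.cons_zero, Fin.cons_succ, Units.val_one, one_smul,
        Units.val_neg, neg_smul]
      rw [add_comm (a 0), neg_add_eq_sub]
    refine (Finset.sum_le_sum fun ε _ => this ε).trans ?_
    simp only [← Finset.mul_sum, Finset.sum_add_distrib, sum_signs_norm_sq,
      Finset.sum_const, Finset.card_univ, card_signs, nsmul_eq_mul]
    have h := ih fun k => a k.succ
    rw [Fin.sum_univ_succ (fun k => ‖a k‖ ^ 2)]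
    set T := ∑ k : Fin m, ‖a k.succ‖ ^ 2
    push_cast
    have : (0 : ℝ) ≤ 2 ^ m * ‖a 0‖ ^ 4 := by positivity
    rw [pow_succ (2 : ℝ) m]
    nlinarith

section Operators

variable {𝕜 : Type*} [RCLike 𝕜] {X : Type*} [NormedAddCommGroup X] [NormedSpace 𝕜 X]

/-- Operators from `ℓ_∞` into a space of cotype `2` are `2`-summing. -/
theorem HasCotype.isSummingFromLinfty_two (h : HasCotype X 2) : IsSummingFromLinfty 𝕜 X 2 := by
  obtain ⟨C, hC, H⟩ := h.exists_sum_rpow_le two_pos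
  simp only [Real.rpow_two] at H
  refine ⟨64 * C ^ 4, by positivity, fun {ι} _ v hv => ?_⟩
  simp only [Real.rpow_two]
  set A : Set ℝ := {t | ∃ (m : ℕ) (b : Fin m → ι → 𝕜), (∀ j, ∑ k, ‖b k j‖ ^ 2 ≤ 1) ∧
    t = ∑ k, ‖v (b k)‖ ^ 2} with hA
  -- A crude dimension-dependent bound; finiteness of `S` is what permits absorbing `3 / 8 * S`
  -- later.
  have hAb : BddAbove A := by
    refine ⟨Fintype.card ι, ?_⟩
    rintro _ ⟨m, b, hb, rfl⟩
    have h1 : ∀ k, ‖v (b k)‖ ^ 2 ≤ ∑ j, ‖b k j‖ ^ 2 := by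
      intro k
      have h2 : ‖v (b k)‖ ≤ ‖b k‖ := by simpa using v.le_of_opNorm_le hv (b k)
      have h3 : ‖b k‖ ≤ Real.sqrt (∑ j, ‖b k j‖ ^ 2) := by
        rw [pi_norm_le_iff_of_nonneg (Real.sqrt_nonneg _)]
        intro j
        refine Real.le_sqrt_of_sq_le ?_
        exact Finset.single_le_sum (f := fun j => ‖b k j‖ ^ 2) (fun _ _ => by positivity)
          (Finset.mem_univ j)
      exact (Real.le_sqrt (norm_nonneg _) (by positivity)).1 (h2.trans h3)
    calc ∑ k, ‖v (b k)‖ ^ 2 ≤ ∑ k, ∑ j, ‖b k j‖ ^ 2 := Finset.sum_le_sum fun k _ => h1 k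
      _ = ∑ j, ∑ k, ‖b k j‖ ^ 2 := Finset.sum_comm
      _ ≤ ∑ j : ι, 1 := Finset.sum_le_sum fun j _ => hb j
      _ = Fintype.card ι := by simp
  have hAn : A.Nonempty := ⟨_, 0, Fin.elim0, by simp, rfl⟩
  set S := sSup A with hS
  have hS0 : 0 ≤ S := by
    refine le_csSup hAb ⟨0, Fin.elim0, by simp, by simp⟩
  have hle : ∀ {κ : Type} [Fintype κ] (b : κ → ι → 𝕜) (M : ℝ), 0 < M →
      (∀ j, ∑ k, ‖b k j‖ ^ 2 ≤ M) → ∑ k, ‖v (b k)‖ ^ 2 ≤ M * S := by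
    intro κ _ b M hM hb
    have hn : ∀ x : X, ‖((Real.sqrt M)⁻¹ : 𝕜) • x‖ ^ 2 = ‖x‖ ^ 2 / M := by
      intro x
      rw [norm_smul, norm_inv, RCLike.norm_ofReal, mul_pow, inv_pow, sq_abs, Real.sq_sqrt hM.le]
      ring
    have h1 := le_csSup hAb ⟨Fintype.card κ,
      fun k => ((Real.sqrt M)⁻¹ : 𝕜) • b ((Fintype.equivFin κ).symm k), fun j => ?_, rfl⟩
    · simp only [map_smul, hn] at h1
      rw [(Fintype.equivFin κ).symm.sum_comp (fun k => ‖v (b k)‖ ^ 2 / M), ← Finset.sum_div,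
        div_le_iff₀ hM] at h1
      linarith
    · have : ∀ k, ‖(((Real.sqrt M)⁻¹ : 𝕜) • b ((Fintype.equivFin κ).symm k)) j‖ ^ 2 =
          ‖b ((Fintype.equivFin κ).symm k) j‖ ^ 2 / M := by
        intro k
        rw [Pi.smul_apply, norm_smul, norm_inv, RCLike.norm_ofReal, mul_pow, inv_pow, sq_abs,
          Real.sq_sqrt hM.le]
        ring
      simp only [this]
      rw [(Fintype.equivFin κ).symm.sum_comp (fun k => ‖b k j‖ ^ 2 / M), ← Finset.sum_div]
      exact (div_le_one hM).2 (hb j)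
  have hmain : S ≤ 32 * C ^ 4 + 3 / 8 * S := by
    refine csSup_le hAn ?_
    rintro _ ⟨m, b, hb, rfl⟩
    set f : (Fin m → ℤˣ) → ι → 𝕜 := fun ε => ∑ k, (ε k : ℤ) • b k with hf
    -- The Rademacher sum is truncated at `4 * C`. The bounded part costs a constant; by the fourth
    -- moment the tail has mean square at most 3/(16C²), so after the cotype inequality it costs C²
    -- · 2 · 3/(16C²) · S = (3/8)S.
    set g : (Fin m → ℤˣ) → ι → 𝕜 := fun ε j => if ‖f ε j‖ ≤ 4 * C then 0 else f ε j with hg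
    have hfj : ∀ ε j, f ε j = ∑ k, (ε k : ℤ) • b k j := fun ε j => by
      simp [hf, Finset.sum_apply]
    have h1 : ∀ j, ∑ ε, ‖g ε j‖ ^ 2 ≤ 3 * 2 ^ m / (16 * C ^ 2) := by
      intro j
      have h2 : ∀ ε, ‖g ε j‖ ^ 2 ≤ ‖f ε j‖ ^ 4 / (16 * C ^ 2) := by
        intro ε
        simp only [hg]
        split_ifs with hε
        · rw [norm_zero, zero_pow two_ne_zero]; positivity
        · rw [le_div_iff₀ (by positivity)]
          have h3 : (4 * C) ^ 2 ≤ ‖f ε j‖ ^ 2 :=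
            pow_le_pow_left₀ (by positivity) (not_le.1 hε).le 2
          nlinarith [sq_nonneg ‖f ε j‖]
      calc ∑ ε, ‖g ε j‖ ^ 2 ≤ ∑ ε, ‖f ε j‖ ^ 4 / (16 * C ^ 2) := Finset.sum_le_sum fun ε _ => h2 ε
        _ = (∑ ε, ‖f ε j‖ ^ 4) / (16 * C ^ 2) := by rw [Finset.sum_div]
        _ ≤ _ := by
          gcongr
          simp only [hfj]
          refine (sum_signs_norm_pow_four_le _).trans
            (mul_le_of_le_one_right (a := 3 * 2 ^ m) (by positivity) ?_)
          exact pow_le_one₀ (Finset.sum_nonneg fun _ _ => sq_nonneg _) (hb j)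
    have h2 := hle g (3 * 2 ^ m / (16 * C ^ 2)) (by positivity) h1
    have h3 : ∀ ε, ‖v (f ε)‖ ^ 2 ≤ 32 * C ^ 2 + 2 * ‖v (g ε)‖ ^ 2 := by
      intro ε
      have h4 : ‖v (f ε - g ε)‖ ≤ 4 * C := by
        refine (v.le_of_opNorm_le hv _).trans ?_
        rw [one_mul, pi_norm_le_iff_of_nonneg (by positivity)]
        intro j
        simp only [Pi.sub_apply, hg]
        split_ifs with hε
        · simpa using hε
        · simp only [sub_self, norm_zero]; positivity
      have h5 : ‖v (f ε)‖ ≤ 4 * C + ‖v (g ε)‖ := by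
        have := norm_add_le (v (f ε - g ε)) (v (g ε))
        rw [← map_add, sub_add_cancel] at this
        linarith
      have h6 := pow_le_pow_left₀ (norm_nonneg _) h5 2
      nlinarith [sq_nonneg (4 * C - ‖v (g ε)‖)]
    have h4 := H m fun k => v (b k)
    rw [mul_pow, Real.sq_sqrt (by positivity)] at h4
    have h5 : ∀ ε : Fin m → ℤˣ, ∑ j, (ε j : ℤ) • v (b j) = v (f ε) := fun ε => by
      rw [hf, map_sum]
      exact Finset.sum_congr rfl fun k _ => (map_zsmul v _ _).symm
    simp only [h5] at h4
    have h6 : ∑ ε, ‖v (f ε)‖ ^ 2 ≤ 2 ^ m * (32 * C ^ 2) + 2 * (3 * 2 ^ m / (16 * C ^ 2) * S) := by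
      refine (Finset.sum_le_sum fun ε _ => h3 ε).trans ?_
      rw [Finset.sum_add_distrib, ← Finset.mul_sum Finset.univ (fun ε => ‖v (g ε)‖ ^ 2) 2,
        Finset.sum_const, Finset.card_univ, card_signs, nsmul_eq_mul]
      push_cast
      linarith
    refine h4.trans ?_
    calc C ^ 2 * ((∑ ε, ‖v (f ε)‖ ^ 2) / 2 ^ m) ≤
          C ^ 2 * ((2 ^ m * (32 * C ^ 2) + 2 * (3 * 2 ^ m / (16 * C ^ 2) * S)) / 2 ^ m) := by
          gcongr
      _ = 32 * C ^ 4 + 3 / 8 * S := by field_simp; ring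
  intro m b hb
  have := le_csSup hAb ⟨m, b, hb, rfl⟩
  have : 0 ≤ C ^ 4 := by positivity
  linarith

/-! ### Duality and weakly summable sequences -/

/-- The operator from `ℓ_∞` that sends the unit vectors to a given finite family. -/
theorem exists_clm_pi_of_norm_sum_le {ι : Type} [Fintype ι] (y : ι → X)
    (hy : ∀ a : ι → 𝕜, (∀ j, ‖a j‖ ≤ 1) → ‖∑ j, a j • y j‖ ≤ 1) :
    ∃ v : (ι → 𝕜) →L[𝕜] X, ‖v‖ ≤ 1 ∧ ∀ a, v a = ∑ j, a j • y j := by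
  refine ⟨∑ j, (ContinuousLinearMap.proj (R := 𝕜) (φ := fun _ : ι => 𝕜) j).smulRight (y j), ?_,
    fun a => by simp⟩
  refine ContinuousLinearMap.opNorm_le_bound _ zero_le_one fun b => ?_
  rw [one_mul]
  simp only [sum_apply, ContinuousLinearMap.smulRight_apply,
    ContinuousLinearMap.proj_apply]
  rcases eq_or_ne b 0 with rfl | hb
  · simp
  have hb' : 0 < ‖b‖ := norm_pos_iff.2 hb
  have h := hy (fun j => (‖b‖ : 𝕜)⁻¹ * b j) fun j => by
    rw [norm_mul, norm_inv, RCLike.norm_ofReal, abs_norm, inv_mul_le_one₀ hb']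
    exact norm_le_pi_norm b j
  simp only [mul_smul, ← Finset.smul_sum] at h
  rwa [norm_smul, norm_inv, RCLike.norm_ofReal, abs_norm, inv_mul_le_one₀ hb'] at h

/-- Dual form of `IsSummingFromLinfty`: families of functionals define `1`-summing operators
into `ℓ_q`. -/
theorem IsSummingFromLinfty.exists_sum_le {q r : ℝ} (hqr : q.HolderConjugate r)
    (h : IsSummingFromLinfty 𝕜 X r) :
    ∃ c : ℝ, 0 < c ∧ ∀ {ι : Type} [Fintype ι] (y : ι → X),
      (∀ a : ι → 𝕜, (∀ j, ‖a j‖ ≤ 1) → ‖∑ j, a j • y j‖ ≤ 1) →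
      ∀ (m : ℕ) (φ : Fin m → X →L[𝕜] 𝕜), ∑ k, ‖φ k‖ ^ q ≤ 1 →
        ∑ j, (∑ k, ‖φ k (y j)‖ ^ q) ^ (1 / q) ≤ c := by
  obtain ⟨c, hc, H⟩ := h
  have hq : 0 < q := hqr.pos
  have hr : 0 < r := hqr.symm.pos
  have hq1 : 1 < q := hqr.lt
  have hqr' : (q - 1) * r = q := by
    have := hqr.mul_eq_add; linarith
  refine ⟨c ^ (1 / r), by positivity, fun {ι} _ y hy m φ hφ => ?_⟩
  obtain ⟨v, hv, hva⟩ := exists_clm_pi_of_norm_sum_le y hy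
  set T : ι → ℝ := fun j => ∑ k, ‖φ k (y j)‖ ^ q with hT
  have hT0 : ∀ j, 0 ≤ T j := fun j => by positivity
  set A : ι → ℝ := fun j => T j ^ (1 / q) with hA
  have hA0 : ∀ j, 0 ≤ A j := fun j => Real.rpow_nonneg (hT0 j) _
  have hAT : ∀ j, A j ^ q = T j := fun j => by
    simp only [hA]; rw [← Real.rpow_mul (hT0 j), one_div_mul_cancel hq.ne', Real.rpow_one]
  -- The norming element for ℓ_q–ℓ_r duality at each `j`: it pairs with `φ k (y j)` to give `A j`.
  -- Where `A j = 0` it vanishes, since `0 ^ (1 - q) = 0` for q > 1.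
  set b : Fin m → ι → 𝕜 := fun k j =>
    ((‖φ k (y j)‖ ^ (q - 2) * A j ^ (1 - q) : ℝ) : 𝕜) * (starRingEnd 𝕜) (φ k (y j)) with hb
  have hbn : ∀ k j, ‖b k j‖ = ‖φ k (y j)‖ ^ (q - 1) * A j ^ (1 - q) := by
    intro k j
    have h1 : 0 ≤ A j ^ (1 - q) := Real.rpow_nonneg (hA0 j) _
    have h2 : ‖φ k (y j)‖ ^ (q - 2) * ‖φ k (y j)‖ = ‖φ k (y j)‖ ^ (q - 1) := by
      rw [← Real.rpow_add_one' (norm_nonneg _) (by linarith)]; congr 1; ring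
    simp only [hb]
    rw [norm_mul, RCLike.norm_conj, RCLike.norm_ofReal, abs_of_nonneg (by positivity), ← h2]
    ring
  have hbz : ∀ k j, b k j * φ k (y j) = ((A j ^ (1 - q) * ‖φ k (y j)‖ ^ q : ℝ) : 𝕜) := by
    intro k j
    have h2 : ‖φ k (y j)‖ ^ (q - 2) * ‖φ k (y j)‖ ^ 2 = ‖φ k (y j)‖ ^ q := by
      rw [← Real.rpow_add_natCast' (norm_nonneg _) (by push_cast; linarith)]; congr 1; push_cast; ring
    simp only [hb]
    rw [mul_assoc, RCLike.conj_mul, ← h2]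
    push_cast
    ring
  have hb1 : ∀ j, ∑ k, ‖b k j‖ ^ r ≤ 1 := by
    intro j
    have h1 : ∀ k, ‖b k j‖ ^ r = ‖φ k (y j)‖ ^ q * A j ^ (-q) := by
      intro k
      rw [hbn, Real.mul_rpow (by positivity) (Real.rpow_nonneg (hA0 j) _),
        ← Real.rpow_mul (norm_nonneg _), ← Real.rpow_mul (hA0 j), hqr']
      congr 2
      linarith
    rw [Finset.sum_congr rfl fun k _ => h1 k, ← Finset.sum_mul]
    change T j * _ ≤ 1
    rw [← hAT j, Real.rpow_neg (hA0 j)]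
    exact mul_inv_le_one
  have hAj : ∀ j, A j ^ (1 - q) * T j = A j := by
    intro j
    rw [← hAT j, ← Real.rpow_add' (hA0 j) (by linarith), sub_add_cancel, Real.rpow_one]
  have hsum : ∑ k, φ k (v (b k)) = ((∑ j, A j : ℝ) : 𝕜) := by
    simp only [hva, map_sum, map_smul, smul_eq_mul, hbz]
    rw [Finset.sum_comm]
    refine Finset.sum_congr rfl fun j _ => ?_
    rw [← map_sum, ← Finset.mul_sum]
    exact congrArg _ (hAj j)
  calc ∑ j, A j = ‖∑ k, φ k (v (b k))‖ := by
        rw [hsum, RCLike.norm_ofReal, abs_of_nonneg (Finset.sum_nonneg fun j _ => hA0 j)]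
    _ ≤ ∑ k, ‖φ k‖ * ‖v (b k)‖ :=
        (norm_sum_le _ _).trans (Finset.sum_le_sum fun k _ => (φ k).le_opNorm _)
    _ ≤ (∑ k, ‖φ k‖ ^ q) ^ (1 / q) * (∑ k, ‖v (b k)‖ ^ r) ^ (1 / r) :=
        Real.inner_le_Lp_mul_Lq_of_nonneg _ hqr (fun _ _ => norm_nonneg _) fun _ _ => norm_nonneg _
    _ ≤ 1 * c ^ (1 / r) := by
        gcongr
        · exact Real.rpow_le_one (by positivity) hφ (by positivity)
        · exact H v hv m b hb1
    _ = c ^ (1 / r) := one_mul _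

theorem IsWeaklySummable.summable {p : ℝ} (hp : 0 < p) {x : ℕ → X}
    (hx : IsWeaklySummable 𝕜 p x) (φ : X →L[𝕜] 𝕜) : Summable fun j => ‖φ (x j)‖ ^ p := by
  have := (memℓp_gen_iff (by rwa [ENNReal.toReal_ofReal hp.le])).1 (hx φ)
  rwa [ENNReal.toReal_ofReal hp.le] at this

theorem isWeaklySummable_of_summable {p : ℝ} (hp : 0 < p) {x : ℕ → X}
    (hx : ∀ φ : X →L[𝕜] 𝕜, Summable fun j => ‖φ (x j)‖ ^ p) : IsWeaklySummable 𝕜 p x := by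
  intro φ
  apply memℓp_gen
  rw [ENNReal.toReal_ofReal hp.le]
  exact hx φ

/-- Uniform boundedness for weakly `p`-summable sequences. -/
theorem IsWeaklySummable.exists_norm_sum_le {p : ℝ} (hp : 0 < p) {x : ℕ → X}
    (hx : IsWeaklySummable 𝕜 p x) :
    ∃ W : ℝ, 0 < W ∧ ∀ (F : Finset ℕ) (a : ℕ → 𝕜),
      (∀ φ : X →L[𝕜] 𝕜, ‖φ (∑ j ∈ F, a j • x j)‖ ≤ (∑ j ∈ F, ‖φ (x j)‖ ^ p) ^ (1 / p)) →
        ‖∑ j ∈ F, a j • x j‖ ≤ W := by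
  -- Coefficients are constrained through the estimate that Hölder would yield, so no dual exponent
  -- appears and p = 1 needs no separate case. The vectors act on the dual, which is complete.
  set I := {Fa : Finset ℕ × (ℕ → 𝕜) // ∀ φ : X →L[𝕜] 𝕜,
    ‖φ (∑ j ∈ Fa.1, Fa.2 j • x j)‖ ≤ (∑ j ∈ Fa.1, ‖φ (x j)‖ ^ p) ^ (1 / p)}
  obtain ⟨W, hW⟩ := banach_steinhaus (𝕜 := 𝕜) (𝕜₂ := 𝕜) (E := StrongDual 𝕜 X) (F := 𝕜)
    (g := fun i : I =>
      NormedSpace.inclusionInDoubleDual 𝕜 X (∑ j ∈ i.1.1, i.1.2 j • x j)) (fun φ =>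
    ⟨(∑' j, ‖φ (x j)‖ ^ p) ^ (1 / p), fun i => by
      rw [NormedSpace.dual_def]
      refine (i.2 φ).trans (Real.rpow_le_rpow (by positivity) ?_ (by positivity))
      exact (hx.summable hp φ).sum_le_tsum _ fun _ _ => by positivity⟩)
  refine ⟨max W 1, by positivity, fun F a ha => le_max_of_le_left ?_⟩
  have := hW ⟨(F, a), ha⟩
  rwa [show ‖NormedSpace.inclusionInDoubleDual 𝕜 X (∑ j ∈ F, a j • x j)‖ = _ from
    (NormedSpace.inclusionInDoubleDualLi 𝕜 (E := X)).norm_map _] at this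

theorem sum_rpow_sub_one_mul_le {ι : Type*} (F : Finset ι) {p : ℝ} (hp : 1 ≤ p) {A t : ι → ℝ}
    (hA : ∀ j, 0 ≤ A j) (ht : ∀ j, 0 ≤ t j) :
    ∑ j ∈ F, A j ^ (p - 1) * t j ≤
      (∑ j ∈ F, A j ^ p) ^ (1 - 1 / p) * (∑ j ∈ F, t j ^ p) ^ (1 / p) := by
  rcases hp.eq_or_lt with rfl | hp
  · simp
  · have hpq := (Real.HolderConjugate.conjExponent hp).symm
    have h := Real.inner_le_Lp_mul_Lq_of_nonneg F hpq (f := fun j => A j ^ (p - 1)) (g := t)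
      (fun j _ => Real.rpow_nonneg (hA j) _) fun j _ => ht j
    have h0 : p - 1 ≠ 0 := by linarith
    have h1 : ∀ j, (A j ^ (p - 1)) ^ p.conjExponent = A j ^ p := fun j => by
      rw [← Real.rpow_mul (hA j), Real.conjExponent]; congr 1; field_simp
    have h2 : 1 / p.conjExponent = 1 - 1 / p := by
      rw [Real.conjExponent]; field_simp
    simpa only [h1, h2] using h

theorem rpow_sum_norm_apply_smul {q : ℝ} (hq : 0 < q) {m : ℕ} (φ : Fin m → X →L[𝕜] 𝕜) (x : X)
    {l : ℝ} (hl : 0 ≤ l) :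
    (∑ k, ‖φ k ((l : 𝕜) • x)‖ ^ q) ^ (1 / q) = l * (∑ k, ‖φ k x‖ ^ q) ^ (1 / q) := by
  have : ∀ k, ‖φ k ((l : 𝕜) • x)‖ ^ q = l ^ q * ‖φ k x‖ ^ q := fun k => by
    rw [map_smul, norm_smul, RCLike.norm_ofReal, abs_of_nonneg hl,
      Real.mul_rpow hl (norm_nonneg _)]
  rw [Finset.sum_congr rfl fun k _ => this k, ← Finset.mul_sum,
    Real.mul_rpow (Real.rpow_nonneg hl _) (Finset.sum_nonneg fun k _ => by positivity),
    ← Real.rpow_mul hl, mul_one_div_cancel hq.ne', Real.rpow_one]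

/-- The case p = 1 is essentially the dual estimate. In general it is applied to the multiples `A j
^ (p - 1) • x j`, normalised by `u * W`, where u is the ℓ_{p'} norm of these coefficients; this
gives G ≤ c W G^{1 - 1/p}. -/
theorem IsSummingFromLinfty.exists_sum_rpow_le {p q r : ℝ} (hp : 1 ≤ p)
    (hqr : q.HolderConjugate r) (h : IsSummingFromLinfty 𝕜 X r) {x : ℕ → X}
    (hx : IsWeaklySummable 𝕜 p x) :
    ∃ B : ℝ, 0 < B ∧ ∀ (F : Finset ℕ) (m : ℕ) (φ : Fin m → X →L[𝕜] 𝕜), ∑ k, ‖φ k‖ ^ q ≤ 1 →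
      ∑ j ∈ F, (∑ k, ‖φ k (x j)‖ ^ q) ^ (p / q) ≤ B := by
  classical
  have hp0 : 0 < p := by linarith
  obtain ⟨c, hc, H⟩ := h.exists_sum_le hqr
  obtain ⟨W, hW, HW⟩ := hx.exists_norm_sum_le hp0
  have hq : 0 < q := hqr.pos
  refine ⟨(c * W) ^ p, by positivity, fun F m φ hφ => ?_⟩
  set A : ℕ → ℝ := fun j => (∑ k, ‖φ k (x j)‖ ^ q) ^ (1 / q) with hA
  have hA0 : ∀ j, 0 ≤ A j := fun j => by positivity
  have hAp : ∀ j, (∑ k, ‖φ k (x j)‖ ^ q) ^ (p / q) = A j ^ p := fun j => by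
    simp only [hA]
    rw [← Real.rpow_mul (by positivity)]; congr 1; ring
  simp only [hAp]
  set G := ∑ j ∈ F, A j ^ p with hG
  have hG0 : 0 ≤ G := Finset.sum_nonneg fun j _ => Real.rpow_nonneg (hA0 j) _
  rcases hG0.eq_or_lt with hG1 | hG1
  · rw [← hG1]; positivity
  set u := G ^ (1 - 1 / p) with hu
  have hu0 : 0 < u := by positivity
  have key := H (ι := F) (fun j => ((A j ^ (p - 1) / (u * W) : ℝ) : 𝕜) • x j) ?_ m φ hφ
  · have h1 : ∀ j, (∑ k, ‖φ k (((A j ^ (p - 1) / (u * W) : ℝ) : 𝕜) • x j)‖ ^ q) ^ (1 / q) =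
        A j ^ p / (u * W) := by
      intro j
      have h2 : 0 ≤ A j ^ (p - 1) / (u * W) :=
        div_nonneg (Real.rpow_nonneg (hA0 j) _) (by positivity)
      have h3 : A j ^ (p - 1) * A j = A j ^ p := by
        rw [← Real.rpow_add_one' (hA0 j) (by linarith)]; congr 1; ring
      rw [rpow_sum_norm_apply_smul hq φ (x j) h2]
      change _ * A j = _
      rw [div_mul_eq_mul_div, h3]
    simp only [h1] at key
    rw [Finset.sum_coe_sort F (fun j => A j ^ p / (u * W)), ← Finset.sum_div,
      div_le_iff₀ (by positivity)] at key
    have h4 : G = u * G ^ (1 / p) := by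
      rw [hu, ← Real.rpow_add hG1, sub_add_cancel, Real.rpow_one]
    have h5 : G ^ (1 / p) ≤ c * W := by
      have : u * G ^ (1 / p) ≤ u * (c * W) := by rw [← h4]; linarith
      exact le_of_mul_le_mul_left this hu0
    calc G = (G ^ (1 / p)) ^ p := by
          rw [← Real.rpow_mul hG0, one_div_mul_cancel hp0.ne', Real.rpow_one]
      _ ≤ (c * W) ^ p := Real.rpow_le_rpow (by positivity) h5 hp0.le
  · intro a ha
    set a' : ℕ → 𝕜 := fun j => if hj : j ∈ F then a ⟨j, hj⟩ else 0 with ha'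
    have ha1 : ∀ j, ‖a' j‖ ≤ 1 := by
      intro j
      simp only [ha']
      split_ifs with hj
      · exact ha _
      · simp
    have h1 : ∑ j : F, a j • ((A j ^ (p - 1) / (u * W) : ℝ) : 𝕜) • x j =
        ((W⁻¹ : ℝ) : 𝕜) • ∑ j ∈ F, (a' j * ((A j ^ (p - 1) / u : ℝ) : 𝕜)) • x j := by
      rw [← Finset.sum_coe_sort F, Finset.smul_sum]
      refine Finset.sum_congr rfl fun j _ => ?_
      have : a' j = a j := by simp [ha']
      rw [this, smul_smul, smul_smul]
      congr 1
      push_cast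
      ring
    rw [h1, norm_smul, RCLike.norm_ofReal, abs_of_pos (by positivity), inv_mul_le_one₀ hW]
    refine HW F _ fun ψ => ?_
    have h2 := sum_rpow_sub_one_mul_le F hp hA0 fun j => norm_nonneg (ψ (x j))
    rw [map_sum]
    calc ‖∑ j ∈ F, ψ ((a' j * ((A j ^ (p - 1) / u : ℝ) : 𝕜)) • x j)‖ ≤
          ∑ j ∈ F, (A j ^ (p - 1) * ‖ψ (x j)‖) / u := by
          refine norm_sum_le_of_le _ fun j _ => ?_
          have h3 : 0 ≤ A j ^ (p - 1) / u := div_nonneg (Real.rpow_nonneg (hA0 j) _) hu0.le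
          rw [map_smul, norm_smul, norm_mul, RCLike.norm_ofReal, abs_of_nonneg h3]
          calc ‖a' j‖ * (A j ^ (p - 1) / u) * ‖ψ (x j)‖ ≤
                1 * (A j ^ (p - 1) / u) * ‖ψ (x j)‖ := by gcongr; exact ha1 j
            _ = _ := by ring
      _ = (∑ j ∈ F, A j ^ (p - 1) * ‖ψ (x j)‖) / u := by rw [Finset.sum_div]
      _ ≤ _ := by rw [div_le_iff₀ hu0]; linarith

end Operators

/-! ### Change of density and factorization -/

/-- Weighted AM–GM, once for x, y and once for their negative powers. This convexity is what the
minimax theorem requires in the variable μ. -/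
theorem rpow_neg_add_le {α x y a b : ℝ} (hα : 0 ≤ α) (hx : 0 < x) (hy : 0 < y) (ha : 0 ≤ a)
    (hb : 0 ≤ b) (hab : a + b = 1) :
    (a * x + b * y) ^ (-α) ≤ a * x ^ (-α) + b * y ^ (-α) := by
  have h1 := Real.geom_mean_le_arith_mean2_weighted ha hb hx.le hy.le hab
  have h2 := Real.geom_mean_le_arith_mean2_weighted ha hb (Real.rpow_nonneg hx.le (-α))
    (Real.rpow_nonneg hy.le (-α)) hab
  refine le_trans ?_ h2
  have h3 : (x ^ (-α)) ^ a * (y ^ (-α)) ^ b = (x ^ a * y ^ b) ^ (-α) := by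
    rw [Real.mul_rpow (by positivity) (by positivity), ← Real.rpow_mul hx.le, ← Real.rpow_mul hy.le,
      ← Real.rpow_mul hx.le, ← Real.rpow_mul hy.le, mul_comm a, mul_comm b]
  rw [h3]
  exact Real.rpow_le_rpow_of_nonpos (by positivity) h1 (by linarith)

/-- A common change of density: a bound for all convex combinations of the rows of `a` yields
one weight `μ` that works for every row. -/
theorem exists_common_weight {J K : Type*} [Fintype J] [Fintype K] [Nonempty K] {p q B : ℝ}
    (hp : 0 < p) (hpq : p < q) (a : K → J → ℝ) (ha : ∀ k j, 0 ≤ a k j)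
    (h : ∀ w ∈ stdSimplex ℝ K, ∑ j, (∑ k, w k * a k j) ^ (p / q) ≤ B) :
    ∃ μ : J → ℝ, (∀ j, 0 < μ j) ∧ ∑ j, μ j ≤ 2 ∧
      ∀ k, ∑ j, a k j * μ j ^ (-(q / p - 1)) ≤ B ^ (q / p) := by
  classical
  have hq : 0 < q := hp.trans hpq
  set α := q / p - 1 with hα
  have hα0 : 0 < α := by rw [hα, sub_pos, one_lt_div hp]; exact hpq
  set ε : ℝ := 1 / (Fintype.card J + 1) with hε
  have hε0 : 0 < ε := by positivity
  have hεJ : ∑ _j : J, ε ≤ 1 := by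
    rw [Finset.sum_const, Finset.card_univ, nsmul_eq_mul, hε, mul_one_div,
      div_le_one (by positivity)]
    linarith
  set M : Set (J → ℝ) := Set.Icc (fun _ => ε) (fun _ => 2) ∩ {μ | ∑ j, μ j ≤ 2} with hM
  set f : (J → ℝ) → (K → ℝ) → ℝ := fun μ w => ∑ k, w k * ∑ j, a k j * μ j ^ (-α) with hf
  have hMpos : ∀ μ ∈ M, ∀ j, 0 < μ j := fun μ hμ j => hε0.trans_le (hμ.1.1 j)
  have hcl : IsClosed {μ : J → ℝ | ∑ j, μ j ≤ 2} := isClosed_le (by fun_prop) continuous_const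
  have hMc : Convex ℝ M := by
    refine (convex_Icc _ _).inter ?_
    intro x hx y hy s t hs ht hst
    simp only [Set.mem_ofPred_eq, Pi.add_apply, Pi.smul_apply, smul_eq_mul, Finset.sum_add_distrib,
      ← Finset.mul_sum] at *
    nlinarith
  have hmem : ∀ x : J → ℝ, (∀ j, ε ≤ x j) → ∑ j, x j ≤ 2 → x ∈ M := by
    intro x h1 h2
    refine ⟨⟨h1, fun j => ?_⟩, h2⟩
    exact (Finset.single_le_sum (f := x) (fun i _ => hε0.le.trans (h1 i)) (Finset.mem_univ j)).trans h2
  obtain ⟨μ, hμ, b, hb, hsad⟩ := Sion.exists_isSaddlePointOn (X := M) (Y := stdSimplex ℝ K) (f := f)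
    ⟨fun _ => ε, hmem _ (fun _ => le_rfl) (by linarith)⟩ hMc (isCompact_Icc.inter_right hcl)
    (by
      intro w _
      refine ContinuousOn.lowerSemicontinuousOn ?_
      refine continuousOn_finsetSum _ fun k _ => continuousOn_const.mul ?_
      refine continuousOn_finsetSum _ fun j _ => continuousOn_const.mul ?_
      exact (continuous_apply j).continuousOn.rpow_const fun μ hμ => Or.inl (hMpos μ hμ j).ne')
    (by
      intro w hw
      refine ConvexOn.quasiconvexOn ⟨hMc, ?_⟩
      intro x hx y hy s t hs ht hst
      simp only [hf, smul_eq_mul]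
      rw [Finset.mul_sum, Finset.mul_sum, ← Finset.sum_add_distrib]
      refine Finset.sum_le_sum fun k _ => ?_
      rw [mul_left_comm s, mul_left_comm t, ← mul_add]
      refine mul_le_mul_of_nonneg_left ?_ (hw.1 k)
      rw [Finset.mul_sum, Finset.mul_sum, ← Finset.sum_add_distrib]
      refine Finset.sum_le_sum fun j _ => ?_
      rw [mul_left_comm s, mul_left_comm t, ← mul_add]
      exact mul_le_mul_of_nonneg_left
        (rpow_neg_add_le hα0.le (hMpos x hx j) (hMpos y hy j) hs ht hst) (ha k j))
    (convex_stdSimplex ℝ K) ⟨_, single_mem_stdSimplex ℝ (Classical.arbitrary K)⟩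
    (isCompact_stdSimplex (𝕜 := ℝ) (ι := K))
    (by
      intro x _
      refine ContinuousOn.upperSemicontinuousOn ?_
      exact Continuous.continuousOn (by fun_prop))
    (by
      intro x _
      refine ConcaveOn.quasiconcaveOn ⟨convex_stdSimplex ℝ K, ?_⟩
      intro w _ w' _ s t hs ht hst
      simp only [hf, smul_eq_mul, Pi.add_apply, Pi.smul_apply]
      rw [Finset.mul_sum, Finset.mul_sum, ← Finset.sum_add_distrib]
      exact le_of_eq (Finset.sum_congr rfl fun k _ => by ring))
  refine ⟨μ, hMpos μ hμ, hμ.2, fun k => ?_⟩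
  set D : J → ℝ := fun j => ∑ k, b k * a k j with hD
  have hD0 : ∀ j, 0 ≤ D j := fun j => Finset.sum_nonneg fun k _ => mul_nonneg (hb.1 k) (ha k j)
  set G := ∑ j, D j ^ (p / q) with hG
  have hG0 : 0 ≤ G := Finset.sum_nonneg fun j _ => Real.rpow_nonneg (hD0 j) _
  have hGB : G ≤ B := h b hb
  -- Up to normalisation `D ^ (p / q)` is the optimal weight for the mixture `b`. Adding `ε` keeps
  -- it in `M`, and the saddle point transfers its bound to every row.
  set x : J → ℝ := fun j => D j ^ (p / q) / G + ε with hx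
  have hx0 : ∀ j, 0 ≤ D j ^ (p / q) / G := fun j => div_nonneg (Real.rpow_nonneg (hD0 j) _) hG0
  have hxM : x ∈ M := by
    refine hmem x (fun j => ?_) ?_
    · simp only [hx]; linarith [hx0 j]
    · simp only [hx]
      rw [Finset.sum_add_distrib, ← Finset.sum_div]
      have := div_self_le_one G
      linarith
  have hs := hsad x hxM _ (single_mem_stdSimplex ℝ k)
  have h1 : f μ (Pi.single k 1) = ∑ j, a k j * μ j ^ (-α) := by
    simp [hf, Pi.single_apply]
  rw [h1] at hs
  refine hs.trans ?_
  have h2 : f x b = ∑ j, D j * x j ^ (-α) := by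
    simp only [hf, hD, Finset.mul_sum, Finset.sum_mul]
    rw [Finset.sum_comm]
    exact Finset.sum_congr rfl fun j _ => Finset.sum_congr rfl fun k _ => by ring
  have h3 : ∀ j, D j * x j ^ (-α) ≤ D j ^ (p / q) * G ^ α := by
    intro j
    rcases (hD0 j).eq_or_lt with hj | hj
    · rw [← hj, zero_mul]; positivity
    · have hGp : 0 < G := (Real.rpow_pos_of_pos hj (p / q)).trans_le
        (Finset.single_le_sum (f := fun j => D j ^ (p / q))
          (fun j _ => Real.rpow_nonneg (hD0 j) _) (Finset.mem_univ j))
      have h4 : x j ^ (-α) ≤ (D j ^ (p / q) / G) ^ (-α) :=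
        Real.rpow_le_rpow_of_nonpos (by positivity) (by simp only [hx]; linarith) (by linarith)
      refine (mul_le_mul_of_nonneg_left h4 hj.le).trans (le_of_eq ?_)
      rw [Real.div_rpow (by positivity) hG0, ← Real.rpow_mul hj.le, Real.rpow_neg hG0, div_inv_eq_mul,
        ← mul_assoc, ← Real.rpow_one_add' hj.le]
      · congr 2
        rw [hα]; field_simp; ring
      · have : 1 + p / q * -α = p / q := by rw [hα]; field_simp; ring
        rw [this]; positivity
  calc f x b ≤ ∑ j, D j ^ (p / q) * G ^ α := by rw [h2]; exact Finset.sum_le_sum fun j _ => h3 j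
    _ = G ^ (q / p) := by
      rw [← Finset.sum_mul, ← hG, ← Real.rpow_one_add' hG0 (by linarith)]
      congr 1; rw [hα]; ring
    _ ≤ B ^ (q / p) := Real.rpow_le_rpow hG0 hGB (by positivity)

section Operators

variable {𝕜 : Type*} [RCLike 𝕜] {X : Type*} [NormedAddCommGroup X] [NormedSpace 𝕜 X]

open scoped ENNReal

/-- Each finite set of functionals and indices has a weight by `exists_common_weight`; compactness
of [0, ∞]^ℕ gives a single one. Values in `ℝ≥0∞` make the negative power continuous, with `0 ^ (-α)
= ∞`. -/
theorem IsSummingFromLinfty.exists_weight {p q r : ℝ} (hp : 1 ≤ p) (hpq : p < q)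
    (hqr : q.HolderConjugate r) (h : IsSummingFromLinfty 𝕜 X r) {x : ℕ → X}
    (hx : IsWeaklySummable 𝕜 p x) :
    ∃ (μ : ℕ → ℝ≥0∞) (B : ℝ≥0∞), B ≠ ∞ ∧ (∀ F : Finset ℕ, ∑ j ∈ F, μ j ≤ 2) ∧
      ∀ φ : X →L[𝕜] 𝕜, ‖φ‖ ≤ 1 → ∀ F : Finset ℕ,
        ∑ j ∈ F, ENNReal.ofReal (‖φ (x j)‖ ^ q) * μ j ^ (-(q / p - 1)) ≤ B := by
  classical
  have hq : 0 < q := by linarith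
  obtain ⟨B, hB, H⟩ := h.exists_sum_rpow_le hp hqr hx
  set I := {φ : X →L[𝕜] 𝕜 // ‖φ‖ ≤ 1} × Finset ℕ
  set C : I → Set (ℕ → ℝ≥0∞) := fun i => {μ | ∑ j ∈ i.2, μ j ≤ 2} ∩
    {μ | ∑ j ∈ i.2, ENNReal.ofReal (‖i.1.1 (x j)‖ ^ q) * μ j ^ (-(q / p - 1)) ≤
      ENNReal.ofReal (B ^ (q / p))} with hC
  have hCc : ∀ i, IsClosed (C i) := by
    intro i
    refine IsClosed.inter (isClosed_le (by fun_prop) continuous_const)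
      (isClosed_le ?_ continuous_const)
    refine continuous_finsetSum _ fun j _ => ?_
    exact (ENNReal.continuous_const_mul ENNReal.ofReal_ne_top).comp
      (ENNReal.continuous_rpow_const.comp (continuous_apply j))
  obtain ⟨μ, -, hμ⟩ := isCompact_univ.inter_iInter_nonempty C hCc (by
    intro u
    rcases u.eq_empty_or_nonempty with rfl | hu
    · simp
    set e := u.equivFin
    have : Nonempty (Fin u.card) := ⟨⟨0, hu.card_pos⟩⟩
    set F := u.biUnion Prod.snd
    set φ : Fin u.card → X →L[𝕜] 𝕜 := fun k => (e.symm k).1.1.1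
    have hφ : ∀ k, ‖φ k‖ ≤ 1 := fun k => (e.symm k).1.1.2
    obtain ⟨ν, hν0, hν2, hν⟩ := exists_common_weight (J := F) (K := Fin u.card) (B := B)
      (by linarith : 0 < p) hpq (fun k j => ‖φ k (x j)‖ ^ q) (fun k j => by positivity) (by
        intro w hw
        have hw1 : ∀ k, (w k ^ (1 / q)) ^ q = w k := fun k => by
          rw [← Real.rpow_mul (hw.1 k), one_div_mul_cancel hq.ne', Real.rpow_one]
        have hw2 : ∀ k, 0 ≤ w k ^ (1 / q) := fun k => Real.rpow_nonneg (hw.1 k) _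
        -- Absorbing `w k ^ (1 / q)` into `φ k` turns the convex combination into a family with ∑
        -- ‖φ_k‖^q ≤ 1.
        have h1 := H F u.card (fun k => ((w k ^ (1 / q) : ℝ) : 𝕜) • φ k) (by
          refine le_trans (Finset.sum_le_sum fun k _ => ?_) hw.2.le
          rw [norm_smul, RCLike.norm_ofReal, abs_of_nonneg (hw2 k),
            Real.mul_rpow (hw2 k) (norm_nonneg _), hw1]
          exact mul_le_of_le_one_right (hw.1 k) (Real.rpow_le_one (norm_nonneg _) (hφ k) hq.le))
        rw [← Finset.sum_coe_sort F] at h1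
        refine le_trans (le_of_eq ?_) h1
        refine Finset.sum_congr rfl fun j _ => ?_
        congr 1
        refine Finset.sum_congr rfl fun k _ => ?_
        rw [smul_apply, norm_smul, RCLike.norm_ofReal, abs_of_nonneg (hw2 k),
          Real.mul_rpow (hw2 k) (norm_nonneg _), hw1])
    set μ : ℕ → ℝ≥0∞ := fun j => if hj : j ∈ F then ENNReal.ofReal (ν ⟨j, hj⟩) else 0 with hμ
    have hμj : ∀ j : F, μ j = ENNReal.ofReal (ν j) := fun j => by simp [hμ]
    refine ⟨μ, Set.mem_univ _, Set.mem_iInter₂.2 fun i hi => ?_⟩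
    have hiF : i.2 ⊆ F := Finset.subset_biUnion_of_mem Prod.snd hi
    constructor
    · change ∑ j ∈ i.2, μ j ≤ 2
      refine (Finset.sum_le_sum_of_subset hiF).trans ?_
      rw [← Finset.sum_coe_sort F, Finset.sum_congr rfl fun j _ => hμj j,
        ← ENNReal.ofReal_sum_of_nonneg fun j _ => (hν0 j).le]
      exact (ENNReal.ofReal_le_ofReal hν2).trans (by simp)
    · change ∑ j ∈ i.2, ENNReal.ofReal (‖i.1.1 (x j)‖ ^ q) * μ j ^ (-(q / p - 1)) ≤ _
      refine (Finset.sum_le_sum_of_subset hiF).trans ?_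
      have h1 := hν (e ⟨i, hi⟩)
      have h2 : φ (e ⟨i, hi⟩) = i.1.1 := by simp [φ]
      rw [h2] at h1
      refine le_trans (le_of_eq ?_) (ENNReal.ofReal_le_ofReal h1)
      rw [ENNReal.ofReal_sum_of_nonneg fun j _ =>
        mul_nonneg (by positivity) (Real.rpow_nonneg (hν0 j).le _), ← Finset.sum_coe_sort F]
      refine Finset.sum_congr rfl fun j _ => ?_
      rw [hμj, ENNReal.ofReal_rpow_of_pos (hν0 j), ENNReal.ofReal_mul (by positivity)])
  rw [Set.mem_iInter] at hμ
  exact ⟨μ, _, ENNReal.ofReal_ne_top, fun F => (hμ (⟨0, by simp⟩, F)).1,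
    fun φ hφ F => (hμ (⟨φ, hφ⟩, F)).2⟩

/-- Weakly `p`-summable sequences are products of an `ℓ_{pq/(q-p)}` sequence and a weakly
`q`-summable one. -/
theorem IsSummingFromLinfty.exists_factorization {p q r : ℝ} (hp : 1 ≤ p) (hpq : p < q)
    (hqr : q.HolderConjugate r) (h : IsSummingFromLinfty 𝕜 X r) {x : ℕ → X}
    (hx : IsWeaklySummable 𝕜 p x) :
    ∃ (l : ℕ → ℝ) (y : ℕ → X), (∀ j, 0 ≤ l j) ∧ Summable (fun j => l j ^ (p * q / (q - p))) ∧
      IsWeaklySummable 𝕜 q y ∧ ∀ j, x j = (l j : 𝕜) • y j := by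
  obtain ⟨μ, B, hB, hμ2, hμ⟩ := h.exists_weight hp hpq hqr hx
  have hp0 : 0 < p := by linarith
  have hq : 0 < q := by linarith
  have hqp : 0 < q - p := by linarith
  set m : ℕ → ℝ := fun j => (μ j).toReal with hm
  have hm0 : ∀ j, 0 ≤ m j := fun j => ENNReal.toReal_nonneg
  have hμt : ∀ j, μ j ≠ ∞ := fun j => ne_top_of_le_ne_top ENNReal.ofNat_ne_top
    (by simpa using hμ2 {j})
  have hα : 0 < q / p - 1 := by rw [sub_pos, one_lt_div hp0]; exact hpq
  have hmx : ∀ j, x j ≠ 0 → 0 < m j := by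
    intro j hj
    obtain ⟨φ, hφ, hφx⟩ := exists_dual_vector 𝕜 (x j) (norm_ne_zero_iff.2 hj)
    have h1 := hμ φ hφ.le {j}
    rw [Finset.sum_singleton] at h1
    have h2 : 0 < ‖φ (x j)‖ := by
      rw [hφx, RCLike.norm_ofReal, abs_norm]; exact norm_pos_iff.2 hj
    refine ENNReal.toReal_pos (fun h0 => ?_) (hμt j)
    rw [h0, ENNReal.zero_rpow_of_neg (by linarith), ENNReal.mul_top
      (by rw [Ne, ENNReal.ofReal_eq_zero, not_le]; positivity)] at h1
    exact hB (top_le_iff.1 h1)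
  -- The exponent is 1/p - 1/q, so that `l ^ (p * q / (q - p)) = m` and `l ^ q = m ^ (q / p - 1)`.
  set l : ℕ → ℝ := fun j => m j ^ ((q - p) / (p * q)) with hl
  have hl0 : ∀ j, 0 ≤ l j := fun j => Real.rpow_nonneg (hm0 j) _
  refine ⟨l, fun j => ((l j)⁻¹ : 𝕜) • x j, hl0, ?_, ?_, ?_⟩
  · have h1 : ∀ j, l j ^ (p * q / (q - p)) = m j := fun j => by
      simp only [hl]
      rw [← Real.rpow_mul (hm0 j), show (q - p) / (p * q) * (p * q / (q - p)) = 1 by field_simp,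
        Real.rpow_one]
    simp only [h1]
    refine summable_of_sum_le hm0 (c := 2) fun F => ?_
    rw [← ENNReal.toReal_sum fun j _ => hμt j]
    exact ENNReal.toReal_le_of_le_ofReal zero_le_two (by simpa using hμ2 F)
  · refine isWeaklySummable_of_summable hq fun φ => ?_
    have h1 : ∀ φ : X →L[𝕜] 𝕜, ∀ j, ENNReal.ofReal (‖φ (((l j)⁻¹ : 𝕜) • x j)‖ ^ q) ≤
        ENNReal.ofReal (‖φ (x j)‖ ^ q) * μ j ^ (-(q / p - 1)) := by
      intro φ j
      rcases eq_or_ne (x j) 0 with hj | hj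
      · simp [hj, Real.zero_rpow hq.ne']
      · have hmj := hmx j hj
        have h2 : l j ^ q = m j ^ (q / p - 1) := by
          simp only [hl]
          rw [← Real.rpow_mul (hm0 j)]; congr 1; field_simp
        rw [← ENNReal.ofReal_toReal (hμt j), ENNReal.ofReal_rpow_of_pos hmj,
          ← ENNReal.ofReal_mul (by positivity)]
        refine ENNReal.ofReal_le_ofReal (le_of_eq ?_)
        rw [map_smul, norm_smul, norm_inv, RCLike.norm_ofReal, abs_of_nonneg (hl0 j),
          Real.mul_rpow (inv_nonneg.2 (hl0 j)) (norm_nonneg _), Real.inv_rpow (hl0 j), h2,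
          Real.rpow_neg (hm0 j), mul_comm]
    have h2 : ∀ φ : X →L[𝕜] 𝕜, ‖φ‖ ≤ 1 →
        Summable fun j => ‖φ (((l j)⁻¹ : 𝕜) • x j)‖ ^ q := by
      intro φ hφ
      refine summable_of_sum_le (fun j => by positivity) (c := B.toReal) fun F => ?_
      rw [← ENNReal.ofReal_le_iff_le_toReal hB, ENNReal.ofReal_sum_of_nonneg fun j _ => by positivity]
      exact (Finset.sum_le_sum fun j _ => h1 φ j).trans (hμ φ hφ F)
    rcases eq_or_ne φ 0 with rfl | hφ
    · simp [Real.zero_rpow hq.ne']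
    have hφ' : 0 < ‖φ‖ := norm_pos_iff.2 hφ
    have h3 := h2 ((‖φ‖⁻¹ : 𝕜) • φ) (by
      rw [norm_smul, norm_inv, RCLike.norm_ofReal, abs_norm, inv_mul_cancel₀ hφ'.ne'])
    simp only [smul_apply, norm_smul ((‖φ‖⁻¹ : 𝕜)), norm_inv,
      RCLike.norm_ofReal, abs_norm, Real.mul_rpow (inv_nonneg.2 hφ'.le) (norm_nonneg _)] at h3
    exact (summable_mul_left_iff (by positivity)).1 h3
  · intro j
    rcases eq_or_ne (x j) 0 with hj | hj
    · simp [hj]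
    · have : (l j : 𝕜) ≠ 0 := by
        have := hmx j hj
        have : 0 < l j := by positivity
        exact_mod_cast this.ne'
      rw [smul_smul, mul_inv_cancel₀ this, one_smul]

end Operators

/-! ### The two inclusions and the main theorem -/

/-- A nonnegative sequence whose products with all `ℓ_P` sequences are summable belongs to the
dual `ℓ_{P'}`. -/
theorem summable_rpow_of_forall_summable_mul {P P' : ℝ} (hP : P.HolderConjugate P') {u : ℕ → ℝ}
    (hu : ∀ j, 0 ≤ u j)
    (H : ∀ v : ℕ → ℝ, (∀ j, 0 ≤ v j) → Summable (fun j => v j ^ P) →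
      Summable fun j => v j * u j) :
    Summable fun j => u j ^ P' := by
  classical
  have hP0 : 0 < P := hP.pos
  have hP0' : 0 < P' := hP.symm.pos
  have hPt : (ENNReal.ofReal P).toReal = P := ENNReal.toReal_ofReal hP0.le
  have : Fact (1 ≤ ENNReal.ofReal P) := ⟨by simpa using hP.lt.le⟩
  have hmul : (P' - 1) * P = P' := by have := hP.mul_eq_add; linarith
  -- The partial-sum functionals are pointwise bounded on ℓ_P, hence uniformly bounded; testing them
  -- on truncations of `u ^ (P' - 1)` bounds the partial sums of `u ^ P'`.
  obtain ⟨K, hK⟩ := banach_steinhaus (𝕜 := ℝ) (𝕜₂ := ℝ)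
    (E := lp (fun _ : ℕ => ℝ) (ENNReal.ofReal P)) (F := ℝ)
    (g := fun N : ℕ => ∑ j ∈ Finset.range N, u j • lp.evalCLM ℝ (fun _ : ℕ => ℝ)
      (ENNReal.ofReal P) j) (fun v => by
      have h1 := H (fun j => |v j|) (fun j => abs_nonneg _) (by
        have := (memℓp_gen_iff (by rwa [hPt])).1 v.2
        simpa [hPt] using this)
      refine ⟨∑' j, |v j| * u j, fun N => ?_⟩
      rw [sum_apply]
      refine (norm_sum_le _ _).trans ?_
      refine le_trans (le_of_eq ?_) (h1.sum_le_tsum (Finset.range N)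
        fun j _ => mul_nonneg (abs_nonneg _) (hu j))
      refine Finset.sum_congr rfl fun j _ => ?_
      change ‖u j * v.1 j‖ = |v.1 j| * u j
      rw [norm_mul, Real.norm_of_nonneg (hu j), mul_comm, Real.norm_eq_abs])
  have hK0 : 0 ≤ K := (norm_nonneg _).trans (hK 0)
  refine summable_of_sum_range_le (c := K ^ P') (fun j => Real.rpow_nonneg (hu j) _) fun N => ?_
  set S := ∑ j ∈ Finset.range N, u j ^ P' with hS
  have hS0 : 0 ≤ S := Finset.sum_nonneg fun j _ => Real.rpow_nonneg (hu j) _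
  rcases hS0.eq_or_lt with h0 | h0
  · rw [← h0]; positivity
  set w : ℕ → ℝ := fun j => if j ∈ Finset.range N then u j ^ (P' - 1) else 0 with hw
  have hwP : ∀ j, ‖w j‖ ^ P = if j ∈ Finset.range N then u j ^ P' else 0 := by
    intro j
    simp only [hw]
    split_ifs with hj
    · rw [Real.norm_of_nonneg (Real.rpow_nonneg (hu j) _), ← Real.rpow_mul (hu j), hmul]
    · rw [norm_zero, Real.zero_rpow hP0.ne']
  have hwm : Memℓp (E := fun _ : ℕ => ℝ) w (ENNReal.ofReal P) := by
    apply memℓp_gen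
    rw [hPt]
    exact summable_of_ne_finset_zero (s := Finset.range N) fun j hj => by rw [hwP, if_neg hj]
  have hwn : ‖(⟨w, hwm⟩ : lp (fun _ : ℕ => ℝ) (ENNReal.ofReal P))‖ = S ^ (1 / P) := by
    rw [lp.norm_eq_tsum_rpow (by rwa [hPt]), hPt]
    congr 1
    change ∑' j, ‖w j‖ ^ P = S
    rw [tsum_eq_sum (s := Finset.range N) fun j hj => by rw [hwP, if_neg hj]]
    exact Finset.sum_congr rfl fun j hj => by rw [hwP, if_pos hj]
  have h1 := ContinuousLinearMap.le_of_opNorm_le _ (hK N)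
    (⟨w, hwm⟩ : lp (fun _ : ℕ => ℝ) (ENNReal.ofReal P))
  have h2 : (∑ j ∈ Finset.range N, u j • lp.evalCLM ℝ (fun _ : ℕ => ℝ) (ENNReal.ofReal P) j)
      (⟨w, hwm⟩ : lp (fun _ : ℕ => ℝ) (ENNReal.ofReal P)) = S := by
    rw [sum_apply]
    refine Finset.sum_congr rfl fun j hj => ?_
    change u j * w j = _
    simp only [hw, if_pos hj]
    rw [← Real.rpow_one_add' (hu j) (by linarith)]
    congr 1; ring
  rw [h2, hwn, Real.norm_of_nonneg hS0] at h1
  have h3 : S = S ^ (1 / P') * S ^ (1 / P) := by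
    rw [← Real.rpow_add h0, one_div, one_div, add_comm, hP.inv_add_inv_eq_one, Real.rpow_one]
  have h4 : S ^ (1 / P') ≤ K := by
    have h5 : S ^ (1 / P') * S ^ (1 / P) ≤ K * S ^ (1 / P) := by rwa [← h3]
    exact le_of_mul_le_mul_right h5 (by positivity)
  calc S = (S ^ (1 / P')) ^ P' := by
        rw [← Real.rpow_mul hS0, one_div_mul_cancel hP0'.ne', Real.rpow_one]
    _ ≤ K ^ P' := Real.rpow_le_rpow (by positivity) h4 hP0'.le

theorem prod_ite_val_lt {n k : ℕ} (hkn : k ≤ n) (c : ℝ) :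
    ∏ i : Fin n, (if (i : ℕ) < k then c else 1) = c ^ k := by
  rw [Fin.prod_univ_eq_prod_range (fun i => if i < k then c else 1), ← Finset.prod_filter]
  have : (Finset.range n).filter (fun i => i < k) = Finset.range k := by
    ext i; simp only [Finset.mem_filter, Finset.mem_range]; omega
  rw [this, Finset.prod_const, Finset.card_range]

section Multilinear

variable {𝕜 : Type*} [RCLike 𝕜] {n : ℕ} {X : Fin n → Type*} [∀ i, NormedAddCommGroup (X i)]
  [∀ i, NormedSpace 𝕜 (X i)] {Y : Type*} [NormedAddCommGroup Y] [NormedSpace 𝕜 Y]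

theorem mem_absSummingClass_iff {r : ℝ} (hr : 0 < r) {q : Fin n → ℝ}
    {T : ContinuousMultilinearMap 𝕜 X Y} :
    T ∈ absSummingClass 𝕜 X Y r q ↔ ∀ x : (i : Fin n) → ℕ → X i,
      (∀ i, IsWeaklySummable 𝕜 (q i) (x i)) → Summable fun j => ‖T fun i => x i j‖ ^ r := by
  refine forall₂_congr fun x _ => ?_
  rw [memℓp_gen_iff (by rwa [ENNReal.toReal_ofReal hr.le]), ENNReal.toReal_ofReal hr.le]

theorem norm_map_ofReal_smul (T : ContinuousMultilinearMap 𝕜 X Y) (c : Fin n → ℝ)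
    (hc : ∀ i, 0 ≤ c i) (x : ∀ i, X i) :
    ‖T fun i => (c i : 𝕜) • x i‖ = (∏ i, c i) * ‖T x‖ := by
  rw [T.map_smul_univ (fun i => (c i : 𝕜)) x, norm_smul, ← RCLike.ofReal_prod, RCLike.norm_ofReal,
    abs_of_nonneg (Finset.prod_nonneg fun i _ => hc i)]

theorem IsWeaklySummable.smul {Z : Type*} [NormedAddCommGroup Z] [NormedSpace 𝕜 Z] {p q : ℝ}
    (hp : 0 < p) (hpq : p < q) {x : ℕ → Z} (hx : IsWeaklySummable 𝕜 q x) {l : ℕ → ℝ}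
    (hl : ∀ j, 0 ≤ l j) (hls : Summable fun j => l j ^ (p * q / (q - p))) :
    IsWeaklySummable 𝕜 p fun j => (l j : 𝕜) • x j := by
  have hq : 0 < q := hp.trans hpq
  have hqp : 0 < q - p := sub_pos.2 hpq
  refine isWeaklySummable_of_summable hp fun φ => ?_
  refine Summable.of_nonneg_of_le (fun j => by positivity) (fun j => ?_)
    ((hls.mul_left ((q - p) / q)).add ((hx.summable hq φ).mul_left (p / q)))
  have h := Real.geom_mean_le_arith_mean2_weighted (w₁ := (q - p) / q) (w₂ := p / q)
    (by positivity) (by positivity) (Real.rpow_nonneg (hl j) (p * q / (q - p)))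
    (Real.rpow_nonneg (norm_nonneg (φ (x j))) q) (by field_simp; ring)
  refine le_trans (le_of_eq ?_) h
  rw [map_smul, norm_smul, RCLike.norm_ofReal, abs_of_nonneg (hl j),
    Real.mul_rpow (hl j) (norm_nonneg _), ← Real.rpow_mul (hl j), ← Real.rpow_mul (norm_nonneg _)]
  congr 2 <;> field_simp

/-- Inclusion theorem for absolutely summing multilinear operators. -/
theorem absSummingClass_subset_of_lt {k : ℕ} (hk1 : 1 ≤ k) (hkn : k ≤ n) {p q z t : ℝ}
    (hp : 0 < p) (hpq : p < q) (hz : 0 < z) :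
    absSummingClass 𝕜 X Y (z * q * p / (z * k * (q - p) + q * p)) (headTail n k p t) ⊆
      absSummingClass 𝕜 X Y z (headTail n k q t) := by
  have hq : 0 < q := hp.trans hpq
  have hqp : 0 < q - p := sub_pos.2 hpq
  have hk : (0 : ℝ) < k := by exact_mod_cast hk1
  set r := z * q * p / (z * k * (q - p) + q * p) with hr
  have hr0 : 0 < r := by positivity
  intro T hT
  rw [mem_absSummingClass_iff hr0] at hT
  rw [mem_absSummingClass_iff hz]
  intro x hx
  -- Conjugacy is the identity kr/ρ + r/z = 1 with ρ = pq/(q - p).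
  have hconj : (p * q / (q - p) / (k * r)).HolderConjugate (z / r) := by
    rw [Real.holderConjugate_iff]
    constructor
    · rw [hr]
      field_simp
      linarith [mul_pos hp hq]
    · rw [hr]
      field_simp
  have key := summable_rpow_of_forall_summable_mul hconj (u := fun j => ‖T fun i => x i j‖ ^ r)
    (fun j => by positivity) (fun v hv hvs => ?_)
  · refine key.congr fun j => ?_
    rw [← Real.rpow_mul (norm_nonneg _), mul_div_cancel₀ _ hr0.ne']
  · set l : ℕ → ℝ := fun j => v j ^ (1 / (k * r)) with hl
    have hl0 : ∀ j, 0 ≤ l j := fun j => Real.rpow_nonneg (hv j) _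
    have hls : Summable fun j => l j ^ (p * q / (q - p)) := by
      refine hvs.congr fun j => ?_
      simp only [hl]
      rw [← Real.rpow_mul (hv j)]
      congr 1; ring
    have h1 := hT (fun i j => (((if (i : ℕ) < k then l j else 1 : ℝ)) : 𝕜) • x i j) (fun i => by
      have hxi := hx i
      by_cases hi : (i : ℕ) < k
      · simp only [headTail, hi, if_true] at hxi ⊢
        exact hxi.smul hp hpq hl0 hls
      · simp only [headTail, hi, if_false, RCLike.ofReal_one, one_smul] at hxi ⊢
        exact hxi)
    refine h1.congr fun j => ?_
    rw [norm_map_ofReal_smul T (fun i : Fin n => if (i : ℕ) < k then l j else 1)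
      (fun i => by split_ifs; exacts [hl0 j, zero_le_one]) fun i => x i j,
      prod_ite_val_lt hkn, Real.mul_rpow (pow_nonneg (hl0 j) _) (norm_nonneg _)]
    congr 1
    simp only [hl]
    rw [← Real.rpow_natCast, ← Real.rpow_mul (hv j), ← Real.rpow_mul (hv j),
      show 1 / (k * r) * k * r = 1 by field_simp, Real.rpow_one]

/-- The reverse inclusion when operators from `ℓ_∞` into the first `k` spaces are summing. -/
theorem subset_absSummingClass_of_isSummingFromLinfty {k : ℕ} (hk1 : 1 ≤ k) (hkn : k ≤ n)
    {p q s z t : ℝ} (hp : 1 ≤ p) (hpq : p < q) (hz : 0 < z) (hqs : q.HolderConjugate s)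
    (h : ∀ i : Fin n, (i : ℕ) < k → IsSummingFromLinfty 𝕜 (X i) s) :
    absSummingClass 𝕜 X Y z (headTail n k q t) ⊆
      absSummingClass 𝕜 X Y (z * q * p / (z * k * (q - p) + q * p)) (headTail n k p t) := by
  have hp0 : 0 < p := by linarith
  have hq : 0 < q := hp0.trans hpq
  have hqp : 0 < q - p := sub_pos.2 hpq
  have hk : (0 : ℝ) < k := by exact_mod_cast hk1
  set r := z * q * p / (z * k * (q - p) + q * p) with hr
  have hr0 : 0 < r := by positivity
  set ρ := p * q / (q - p) with hρ
  have hρ0 : 0 < ρ := by positivity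
  intro T hT
  rw [mem_absSummingClass_iff hz] at hT
  rw [mem_absSummingClass_iff hr0]
  intro x hx
  have hfac : ∀ i : Fin n, ∃ (l : ℕ → ℝ) (y : ℕ → X i), (∀ j, 0 ≤ l j) ∧
      ((i : ℕ) < k → Summable fun j => l j ^ ρ) ∧ IsWeaklySummable 𝕜 (headTail n k q t i) y ∧
      ∀ j, x i j = (((if (i : ℕ) < k then l j else 1 : ℝ)) : 𝕜) • y j := by
    intro i
    have hxi := hx i
    by_cases hi : (i : ℕ) < k
    · simp only [headTail, hi, if_true] at hxi ⊢
      obtain ⟨l, y, h1, h2, h3, h4⟩ := (h i hi).exists_factorization hp hpq hqs hxi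
      exact ⟨l, y, h1, fun _ => h2, h3, h4⟩
    · simp only [headTail, hi, if_false] at hxi ⊢
      exact ⟨fun _ => 1, x i, fun _ => zero_le_one, fun h => h.elim, hxi, fun j => by simp⟩
  choose l y hl0 hls hy hxy using hfac
  have hTy := hT y hy
  set I := Finset.univ.filter fun i : Fin n => (i : ℕ) < k with hI
  have hIk : I.card = k := by
    have := prod_ite_val_lt hkn 2
    rw [← Finset.prod_filter, Finset.prod_const] at this
    exact Nat.pow_right_injective le_rfl (by exact_mod_cast this)
  refine Summable.of_nonneg_of_le (fun j => by positivity) (fun j => ?_)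
    ((summable_sum fun i (hi : i ∈ I) => hls i (Finset.mem_filter.1 hi).2).add hTy)
  -- Generalised Hölder by domination: each factor is at most a power of the summable `M`, and the
  -- exponents (k/ρ + 1/z)r add up to 1.
  set M := ∑ i ∈ I, l i j ^ ρ + ‖T fun i => y i j‖ ^ z with hM
  have hM1 : ∀ i ∈ I, l i j ^ ρ ≤ M := fun i hi => by
    have h1 := Finset.single_le_sum (f := fun i => l i j ^ ρ)
      (fun i _ => Real.rpow_nonneg (hl0 i j) _) hi
    have h2 : 0 ≤ ‖T fun i => y i j‖ ^ z := by positivity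
    linarith
  have hS0 : 0 ≤ ∑ i ∈ I, l i j ^ ρ := Finset.sum_nonneg fun i _ => Real.rpow_nonneg (hl0 i j) _
  have hM0 : 0 ≤ M := by positivity
  have h1 : ∏ i ∈ I, l i j ≤ (M ^ (1 / ρ)) ^ k := by
    rw [← hIk]
    refine (Finset.prod_le_prod (fun i _ => hl0 i j) fun i hi => ?_).trans_eq
      (Finset.prod_const _)
    rw [one_div, Real.le_rpow_inv_iff_of_pos (hl0 i j) hM0 hρ0]
    exact hM1 i hi
  have h2 : ‖T fun i => y i j‖ ≤ M ^ (1 / z) := by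
    rw [one_div, Real.le_rpow_inv_iff_of_pos (norm_nonneg _) hM0 hz]
    linarith
  have h3 : ‖T fun i => x i j‖ = (∏ i ∈ I, l i j) * ‖T fun i => y i j‖ := by
    simp only [hxy]
    rw [norm_map_ofReal_smul T (fun i : Fin n => if (i : ℕ) < k then l i j else 1)
      (fun i => by split_ifs; exacts [hl0 i j, zero_le_one]) fun i => y i j, hI, Finset.prod_filter]
  have h4 : 0 ≤ ∏ i ∈ I, l i j := Finset.prod_nonneg fun i _ => hl0 i j
  calc ‖T fun i => x i j‖ ^ r ≤ ((M ^ (1 / ρ)) ^ k * M ^ (1 / z)) ^ r := by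
        rw [h3]; gcongr
    _ = M := by
        rw [← Real.rpow_natCast, ← Real.rpow_mul hM0, ← Real.rpow_add_of_nonneg hM0 (by positivity)
          (by positivity), ← Real.rpow_mul hM0]
        have : (1 / ρ * k + 1 / z) * r = 1 := by rw [hr, hρ]; field_simp
        rw [this, Real.rpow_one]

end Multilinear

theorem mainTheorem1 {𝕜 : Type*} [RCLike 𝕜] (n k : ℕ) (hn : 2 ≤ n) (hk1 : 1 ≤ k) (hkn : k ≤ n)
    (X : Fin n → Type*) [∀ i, NormedAddCommGroup (X i)] [∀ i, NormedSpace 𝕜 (X i)]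
    [∀ i, CompleteSpace (X i)]
    (Y : Type*) [NormedAddCommGroup Y] [NormedSpace 𝕜 Y] [CompleteSpace Y]
    (s : Fin n → ℝ) (hs : ∀ i : Fin n, (i : ℕ) < k → 2 ≤ s i ∧ HasCotype (X i) (s i))
    (p q : ℝ) (hp : 1 ≤ p) (hpq : p ≤ q)
    (hq : ((∃ i : Fin n, (i : ℕ) < k ∧ 2 < s i) ∧
            ∀ i : Fin n, (i : ℕ) < k → q < Real.conjExponent (s i)) ∨
          ((∀ i : Fin n, (i : ℕ) < k → s i = 2) ∧ q ≤ 2)) :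
    (∀ z t : ℝ, 1 ≤ z → 1 ≤ t →
      absSummingClass 𝕜 X Y z (headTail n k q t) =
        absSummingClass 𝕜 X Y (z * q * p / (z * k * (q - p) + q * p)) (headTail n k p t)) ∧
    (k = n → ∀ z : ℝ, 1 ≤ z →
      absSummingClass 𝕜 X Y z (fun _ => q) =
        absSummingClass 𝕜 X Y (z * q * p / (z * k * (q - p) + q * p)) (fun _ => p)) := by
  have main : ∀ z t : ℝ, 1 ≤ z → 1 ≤ t →
      absSummingClass 𝕜 X Y z (headTail n k q t) =
        absSummingClass 𝕜 X Y (z * q * p / (z * k * (q - p) + q * p)) (headTail n k p t) := by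
    intro z t hz _
    have hz0 : 0 < z := by linarith
    rcases hpq.eq_or_lt with rfl | hpq
    · congr 1
      field_simp
      ring
    have hq1 : 1 < q := by linarith
    have hsum : ∀ i : Fin n, (i : ℕ) < k → IsSummingFromLinfty 𝕜 (X i) q.conjExponent := by
      intro i hi
      obtain ⟨hs2, hcot⟩ := hs i hi
      have of_lt : q < Real.conjExponent (s i) → IsSummingFromLinfty 𝕜 (X i) q.conjExponent := by
        intro hlt
        refine hcot.isSummingFromLinfty (by linarith) ?_
        -- For exponents above 1, q < s* is equivalent to s < q*.
        rw [Real.conjExponent, lt_div_iff₀ (by linarith)] at hlt ⊢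
        linarith
      rcases hq with ⟨-, hq⟩ | ⟨hs2', hq2⟩
      · exact of_lt (hq i hi)
      · rcases hq2.eq_or_lt with rfl | hq2
        · have : Real.conjExponent 2 = 2 := by norm_num [Real.conjExponent]
          rw [this]
          rw [hs2' i hi] at hcot
          exact hcot.isSummingFromLinfty_two
        · refine of_lt ?_
          rw [hs2' i hi]
          norm_num [Real.conjExponent]
          exact hq2
    exact Set.Subset.antisymm
      (subset_absSummingClass_of_isSummingFromLinfty hk1 hkn hp hpq hz0
        (Real.HolderConjugate.conjExponent hq1) hsum)
      (absSummingClass_subset_of_lt hk1 hkn (by linarith) hpq hz0)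
  refine ⟨main, ?_⟩
  rintro rfl z hz
  have h : ∀ a : ℝ, headTail k k a 1 = fun _ => a := fun a => by
    funext i
    simp [headTail]
  simpa only [h] using main z 1 hz le_rfl
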